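/- **Theorem 2.3.** For an even integer $n\ge 2$ let $G_n=(V,E)$ be the grid graph with vertex set $V=\{(i,j)\in\mathbb Z^2: 1\le i,j\le n\}$ and nearest-neighbour edges, and let $u=(1,n/2)$, $v=(n,n/2)$. Let $J=(J_e)_{e\in E}$ be i.i.d. standard Gaussian couplings and let $\sigma=\sigma(J)\in\{-1,+1\}^V$ be a ground state, i.e. a maximizer of $H(\sigma)=\sum_{e=\{x,y\}\in E}J_e\sigma_x\sigma_y$ (almost surely unique up to a global sign, so that $\sigma_u\sigma_v$ is almost surely a well-defined function of $J$). Let $h_k$, $k\ge 0$, be the Hermite polynomials normalized to be orthonormal with respect to the standard Gaussian law. For $\mathbf k=(k_e)_{e\in E}\in\{0,1,2,\dots\}^E$ put $h_{\mathbf k}(J)=\prod_{e\in E}h_{k_e}(J_e)$, $\alpha_{\mathbf k}=\mathbb E[\sigma_u\sigma_v\,h_{\mathbf k}(J)]$ and $E_{\mathbf k}=\{e\in E:k_e\ge 1\}$, and for $S\subseteq E$ define the spectral mass $$\mu(S)=\sum_{\mathbf k:\,E_{\mathbf k}=S}\alpha_{\mathbf k}^2 .$$ Then there exist $\varepsilon,c>0$,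 independent of $n$, such that for every even $n\ge 2$ $$\sum_{S\subseteq E,\ |S|\le(1+\varepsilon)n}\mu(S)\le \exp(-cn).$$ -/

import Mathlib

namespace EdwardsAnderson

open MeasureTheory ProbabilityTheory

noncomputable section

section Model

variable {V : Type*} [Fintype V] [DecidableEq V] (G : SimpleGraph V) [DecidableRel G.Adj]

/-- The energy `H(σ) = ∑_{e = {u,v}} J_e σ_u σ_v` of a spin configuration with values in
`ℤˣ = {1, -1}`, for the couplings `J`. -/
def hamiltonian (J : G.edgeSet → ℝ) (σ : V → ℤˣ) : ℝ :=
  ∑ e : G.edgeSet, J e * (((e.1.map σ).mul : ℤˣ) : ℤ)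

/-- Ground states are the maximizers of the energy (no minus sign in the convention). -/
def IsGroundState (J : G.edgeSet → ℝ) (σ : V → ℤˣ) : Prop :=
  ∀ τ : V → ℤˣ, hamiltonian G J τ ≤ hamiltonian G J σ

theorem exists_isGroundState (J : G.edgeSet → ℝ) :
    ∃ σ : V → ℤˣ, IsGroundState G J σ :=
  Finite.exists_max (hamiltonian G J)

/-- A ground state for the couplings `J`. For almost every `J` (with respect to the Gaussian
measure, `G` connected) it is unique up to a global sign. -/
def groundState (J : G.edgeSet → ℝ) : V → ℤˣ :=
  Classical.choose (exists_isGroundState G J)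

/-- The relative spin `σ_u σ_v` of the ground state, as a function of the couplings. -/
def relativeSpin (u v : V) (J : G.edgeSet → ℝ) : ℝ :=
  ((groundState G J u * groundState G J v : ℤˣ) : ℤ)

/-- The law of i.i.d. standard Gaussian couplings. -/
def couplingLaw : Measure (G.edgeSet → ℝ) :=
  Measure.pi fun _ => gaussianReal 0 1

/-- The Hermite polynomials `h_k`, orthonormal for the standard Gaussian
(`Polynomial.hermite` is the monic version, with squared norm `k!`). -/
def hermiteNormalized (k : ℕ) (x : ℝ) : ℝ :=
  Polynomial.aeval x (Polynomial.hermite k) / √(k.factorial : ℝ)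

/-- The tensor-product basis functions `h_k(J) = ∏_e h_{k_e}(J_e)`. -/
def hermiteTensor (k : G.edgeSet → ℕ) (J : G.edgeSet → ℝ) : ℝ :=
  ∏ e : G.edgeSet, hermiteNormalized (k e) (J e)

/-- The Fourier coefficient `α_k = E[σ_u σ_v h_k(J)]`. -/
def fourierCoeff (u v : V) (k : G.edgeSet → ℕ) : ℝ :=
  ∫ J, relativeSpin G u v J * hermiteTensor G k J ∂(couplingLaw G)

/-- The support `E_k = {e : k_e ≥ 1}` of a multi-index. -/
def edgeSupport (k : G.edgeSet → ℕ) : Finset G.edgeSet :=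
  {e | 1 ≤ k e}

/-- The spectral mass `μ(S) = ∑_{k : E_k = S} α_k²` of an edge set `S`. The sum is taken in
`[0, ∞]`, so that no summability convention intervenes. -/
def spectralMass (u v : V) (S : Finset G.edgeSet) : ENNReal :=
  ∑' k : {k : G.edgeSet → ℕ // edgeSupport G k = S}, ENNReal.ofReal (fourierCoeff G u v k.1 ^ 2)

end Model

/-- The vertices `(i, j) ∈ ℤ²` with `1 ≤ i, j ≤ n`. -/
abbrev GridVertex (n : ℕ) : Type :=
  {p : ℤ × ℤ // p ∈ Finset.Icc (1 : ℤ) n ×ˢ Finset.Icc (1 : ℤ) n}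

/-- The `n × n` grid with nearest neighbor edges. -/
def grid (n : ℕ) : SimpleGraph (GridVertex n) where
  Adj p q := |p.1.1 - q.1.1| + |p.1.2 - q.1.2| = 1
  symm := ⟨fun p q h => by rw [abs_sub_comm q.1.1, abs_sub_comm q.1.2]; exact h⟩
  loopless := ⟨fun p h => by simp at h⟩

instance (n : ℕ) : DecidableRel (grid n).Adj :=
  fun p q => inferInstanceAs (Decidable (|p.1.1 - q.1.1| + |p.1.2 - q.1.2| = 1))

/-- The vertex `(1, n/2)`. -/
def leftVertex (n : ℕ) (hn : 2 ≤ n) : GridVertex n :=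
  ⟨(1, (n : ℤ) / 2), by simp only [Finset.mem_product, Finset.mem_Icc]; omega⟩

/-- The vertex `(n, n/2)`. -/
def rightVertex (n : ℕ) (hn : 2 ≤ n) : GridVertex n :=
  ⟨((n : ℤ), (n : ℤ) / 2), by simp only [Finset.mem_product, Finset.mem_Icc]; omega⟩

end

end EdwardsAnderson

set_option linter.unusedSectionVars false

namespace EdwardsAnderson

open MeasureTheory ProbabilityTheory

/-! ### Hermite polynomials: orthonormality and parity. -/

section Hermite

open Polynomial

/-! The proof weighs the exponential decay of a coefficient family attached to a path against the
number of nearly straight paths.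

Gauge symmetry. Flipping spins on a vertex set, and the couplings on its boundary, preserves the
Gaussian law. Taking the component of `u` among the odd edges of `k` shows that `α_k = 0` unless
these odd edges connect `u` to `v` (`reachable_oddGraph`). If moreover `|E_k| ≤ (1+ε)n`, the
connecting path is almost as short as possible, so it has odd horizontal crossings of all `n - 1`
column gaps, at heights of total variation at most `2εn` (`exists_heightList`).

Decay for one crossing sequence. Complete a crossing edge `ab` to a unit square. If the other three
sides are strong and all remaining edges touching the square are weak, the ground state satisfies
those three sides. This fixes `σ_a σ_b`, so the ground states do not change with the sign of `J_ab`.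
Such configurations contribute zero to `α_k` when `k_ab` is odd. Hence, for all `k` odd on the
chosen edges, `α_k` is also the coefficient of `σ_u σ_v` restricted to the event that no chosen
square is shielded. Bessel's inequality bounds the total mass of these `k` by the probability of
that event, and using every third column makes the squares independent: the bound is `q ^ ((n+1)/3)`
with `q < 1` (`tsum_sq_fourierCoeff_le`).

Entropy. An exponential moment bound shows that height sequences of variation at most `2εn` number
at most `exp(δn)`, with `δ` small when `ε` is (`card_heightLists_crossCost_le`). A union bound over
them (`sum_spectralMass_le`) finishes the proof. -/

theorem integrable_eval_gaussianReal (p : ℝ[X]) :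
    Integrable (fun x => p.eval x) (gaussianReal 0 1) := by
  induction p using Polynomial.induction_on' with
  | add p q hp hq =>
    simp only [eval_add]
    exact hp.add hq
  | monomial n a =>
    simp only [eval_monomial]
    refine Integrable.const_mul ?_ a
    have h := (memLp_id_gaussianReal (μ := 0) (v := 1) n).integrable_norm_pow'
    refine (integrable_norm_iff (by fun_prop)).1 ?_
    simpa using h

/-- Gaussian integration by parts for polynomials. -/
theorem integral_mul_eval_gaussianReal (p : ℝ[X]) :
    ∫ x, x * p.eval x ∂(gaussianReal 0 1) = ∫ x, (derivative p).eval x ∂(gaussianReal 0 1) := by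
  have hint : ∀ q : ℝ[X], Integrable (fun x => q.eval x * gaussianPDFReal 0 1 x) := by
    intro q
    have h := integrable_eval_gaussianReal q
    rw [gaussianReal_of_var_ne_zero _ one_ne_zero,
      integrable_withDensity_iff (measurable_gaussianPDF 0 1)
        (ae_of_all _ fun _ => gaussianPDF_lt_top)] at h
    simpa [toReal_gaussianPDF] using h
  have hderiv : ∀ x, HasDerivAt (gaussianPDFReal 0 1) (-x * gaussianPDFReal 0 1 x) x := by
    intro x
    rw [gaussianPDFReal_def]
    have h : HasDerivAt (fun x : ℝ => -(x - 0) ^ 2 / (2 * ((1 : NNReal) : ℝ))) (-x) x := by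
      have := ((((hasDerivAt_id x).sub_const 0).pow 2).neg).div_const (2 * ((1 : NNReal) : ℝ))
      refine this.congr_deriv ?_
      simp [neg_div]
    refine (h.exp.const_mul (√(2 * Real.pi * ((1 : NNReal) : ℝ)))⁻¹).congr_deriv ?_
    ring
  have key := integral_mul_deriv_eq_deriv_mul_of_integrable
    (u := fun x => p.eval x) (u' := fun x => (derivative p).eval x)
    (v := gaussianPDFReal 0 1) (v' := fun x => -x * gaussianPDFReal 0 1 x)
    (fun x _ => p.hasDerivAt x) (fun x _ => hderiv x)
    (by
      refine (hint (-(X * p))).congr (ae_of_all _ fun x => ?_)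
      simp
      ring)
    (hint _) (hint _)
  rw [integral_gaussianReal_eq_integral_smul one_ne_zero,
    integral_gaussianReal_eq_integral_smul one_ne_zero]
  simp only [smul_eq_mul]
  rw [← neg_inj]
  calc -∫ x, gaussianPDFReal 0 1 x * (x * p.eval x)
      = ∫ x, p.eval x * (-x * gaussianPDFReal 0 1 x) := by
        rw [← integral_neg]; exact integral_congr_ae (ae_of_all _ fun x => by ring)
    _ = _ := by
        rw [key, neg_inj]; exact integral_congr_ae (ae_of_all _ fun x => by ring)

/-- The Hermite polynomials with real coefficients. -/
noncomputable abbrev realHermite (n : ℕ) : ℝ[X] := (hermite n).map (algebraMap ℤ ℝ)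

theorem realHermite_succ (n : ℕ) :
    realHermite (n + 1) = X * realHermite n - derivative (realHermite n) := by
  simp [realHermite, hermite_succ, derivative_map]

/-- Repeated Gaussian integration by parts. Orthogonality follows, since `n` derivatives kill every
polynomial of degree below `n`. -/
theorem integral_realHermite_mul (n : ℕ) (q : ℝ[X]) :
    ∫ x, (realHermite n * q).eval x ∂(gaussianReal 0 1) =
      ∫ x, (derivative^[n] q).eval x ∂(gaussianReal 0 1) := by
  induction n generalizing q with
  | zero => simp [realHermite]
  | succ n ih =>
    rw [Function.iterate_succ_apply, ← ih]
    have h := integral_mul_eval_gaussianReal (realHermite n * q)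
    have e : realHermite (n + 1) * q
        = X * (realHermite n * q) - derivative (realHermite n) * q := by
      rw [realHermite_succ]; ring
    have e' : derivative (realHermite n * q)
        = derivative (realHermite n) * q + realHermite n * derivative q := by
      rw [derivative_mul]
    have i₁ := integrable_eval_gaussianReal (X * (realHermite n * q))
    have i₂ := integrable_eval_gaussianReal (derivative (realHermite n) * q)
    have i₃ := integrable_eval_gaussianReal (realHermite n * derivative q)
    rw [e]
    simp only [eval_sub]
    rw [integral_sub i₁ i₂]
    have h1 : ∫ x, (X * (realHermite n * q)).eval x ∂(gaussianReal 0 1)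
        = ∫ x, x * (realHermite n * q).eval x ∂(gaussianReal 0 1) := by simp
    rw [h1, h, e']
    simp only [eval_add]
    rw [integral_add i₂ i₃]
    ring

theorem iterate_derivative_realHermite_self (n : ℕ) :
    derivative^[n] (realHermite n) = C (n.factorial : ℝ) := by
  have hdeg : (realHermite n).natDegree = n := by
    rw [realHermite, (hermite_monic n).natDegree_map, natDegree_hermite]
  have h0 : (derivative^[n] (realHermite n)).natDegree = 0 := by
    have := natDegree_iterate_derivative (realHermite n) n
    omega
  rw [eq_C_of_natDegree_eq_zero h0, coeff_iterate_derivative]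
  simp [realHermite, Nat.descFactorial_self]

theorem hermiteNormalized_eq (n : ℕ) (x : ℝ) :
    hermiteNormalized n x = (realHermite n).eval x / √(n.factorial : ℝ) := by
  rw [hermiteNormalized, realHermite, eval_map_algebraMap]

theorem continuous_hermiteNormalized (n : ℕ) : Continuous (hermiteNormalized n) := by
  have : hermiteNormalized n = fun x => (realHermite n).eval x / √(n.factorial : ℝ) :=
    funext (hermiteNormalized_eq n)
  rw [this]
  fun_prop

theorem integrable_hermiteNormalized_mul (m n : ℕ) :
    Integrable (fun x => hermiteNormalized m x * hermiteNormalized n x) (gaussianReal 0 1) := by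
  have h := (integrable_eval_gaussianReal (realHermite m * realHermite n)).div_const
    (√(m.factorial : ℝ) * √(n.factorial : ℝ))
  refine h.congr (ae_of_all _ fun x => ?_)
  simp only [hermiteNormalized_eq, eval_mul]
  rw [div_mul_div_comm]

theorem integral_hermiteNormalized_mul (m n : ℕ) :
    ∫ x, hermiteNormalized m x * hermiteNormalized n x ∂(gaussianReal 0 1) =
      if m = n then 1 else 0 := by
  have hred : ∀ a b : ℕ, ∫ x, hermiteNormalized a x * hermiteNormalized b x ∂(gaussianReal 0 1) =
      (∫ x, (realHermite a * realHermite b).eval x ∂(gaussianReal 0 1)) /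
        (√(a.factorial : ℝ) * √(b.factorial : ℝ)) := by
    intro a b
    rw [← integral_div]
    refine integral_congr_ae (ae_of_all _ fun x => ?_)
    simp only [hermiteNormalized_eq, eval_mul]
    rw [div_mul_div_comm]
  have hlt : ∀ a b : ℕ, b < a →
      ∫ x, hermiteNormalized a x * hermiteNormalized b x ∂(gaussianReal 0 1) = 0 := by
    intro a b hab
    rw [hred, integral_realHermite_mul, iterate_derivative_eq_zero]
    · simp
    · rw [realHermite, (hermite_monic b).natDegree_map, natDegree_hermite]
      exact hab
  split_ifs with h
  · subst h
    rw [hred, integral_realHermite_mul, iterate_derivative_realHermite_self]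
    simp only [eval_C, integral_const, probReal_univ, smul_eq_mul, one_mul]
    rw [Real.mul_self_sqrt (by positivity), div_self (by positivity)]
  · rcases lt_or_gt_of_ne h with h | h
    · simp_rw [mul_comm (hermiteNormalized m _)]
      exact hlt n m h
    · exact hlt m n h

/-- Only the parity of the index matters under sign changes of couplings; both cancellation
arguments below rest on this. -/
theorem hermiteNormalized_neg (n : ℕ) (x : ℝ) :
    hermiteNormalized n (-x) = (-1) ^ n * hermiteNormalized n x := by
  have h : (realHermite n).comp (-X) = (-1) ^ n * realHermite n := by
    induction n with
    | zero => simp [realHermite]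
    | succ n ih =>
      have hd := congrArg derivative ih
      have hc : derivative ((-1 : ℝ[X]) ^ n) = 0 := by
        rw [show ((-1 : ℝ[X]) ^ n) = C ((-1) ^ n) by simp, derivative_C]
      rw [derivative_comp, derivative_mul, hc] at hd
      simp only [derivative_neg, derivative_X, zero_mul, zero_add] at hd
      rw [realHermite_succ, sub_comp, mul_comp, ih, X_comp]
      linear_combination hd
  have h' := congrArg (eval x) h
  simp only [eval_comp, eval_neg, eval_X, eval_mul, eval_pow, eval_one] at h'
  rw [hermiteNormalized_eq, hermiteNormalized_eq, h', mul_div_assoc]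

end Hermite

/-! ### Product Gaussian measure: sign symmetry, independence of blocks, Bessel's inequality. -/

section Product

variable {ι : Type*} [Fintype ι]

/-- The law of a finite family of independent standard Gaussian variables. -/
noncomputable abbrev stdGaussianPi (ι : Type*) [Fintype ι] : Measure (ι → ℝ) :=
  Measure.pi fun _ => gaussianReal 0 1

theorem measurePreserving_signs (s : ι → ℤˣ) :
    MeasurePreserving (fun (J : ι → ℝ) i => ((s i : ℤ) : ℝ) * J i)
      (stdGaussianPi ι) (stdGaussianPi ι) := by
  refine measurePreserving_pi _ _ (f := fun i x => ((s i : ℤ) : ℝ) * x) fun i => ?_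
  refine ⟨by fun_prop, ?_⟩
  rw [gaussianReal_map_const_mul]
  rcases Int.units_eq_one_or (s i) with h | h <;> simp [h]

theorem integral_comp_signs (s : ι → ℤˣ) (f : (ι → ℝ) → ℝ) :
    ∫ J, f (fun i => ((s i : ℤ) : ℝ) * J i) ∂(stdGaussianPi ι) = ∫ J, f J ∂(stdGaussianPi ι) := by
  let e : (ι → ℝ) ≃ᵐ (ι → ℝ) := MeasurableEquiv.ofInvolutive
    (fun (J : ι → ℝ) i => ((s i : ℤ) : ℝ) * J i)
    (fun J => by
      funext i
      rcases Int.units_eq_one_or (s i) with h | h <;> simp [h]) (by fun_prop)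
  exact (measurePreserving_signs s).integral_comp e.measurableEmbedding f

instance : IsGaussian (stdGaussianPi ι) := by
  have h := (iIndepFun.hasGaussianLaw (P := stdGaussianPi ι) (X := fun i J => J i)
    (fun i => ⟨by
      rw [(measurePreserving_eval (fun _ : ι => gaussianReal 0 1) i).map_eq]
      infer_instance⟩)
    (iIndepFun_pi (X := fun _ => id) fun _ => aemeasurable_id)).isGaussian_map
  simpa using h

/-- The linear form with coefficients `c` is Gaussian with variance `∑ c i ^ 2 > 0`, hence has no
atoms. -/
theorem measure_hyperplane_eq_zero (c : ι → ℝ) (hc : c ≠ 0) :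
    stdGaussianPi ι {J | ∑ i, c i * J i = 0} = 0 := by
  let L : (ι → ℝ) →L[ℝ] ℝ := ∑ i, c i • ContinuousLinearMap.proj i
  have hL : ∀ J, L J = ∑ i, c i * J i := by intro J; simp [L]
  have hmap := IsGaussian.map_eq_gaussianReal (μ := stdGaussianPi ι) L
  have hvar : Var[L; stdGaussianPi ι] = ∑ i, c i ^ 2 := by
    have h := variance_sum_pi (μ := fun _ : ι => gaussianReal 0 1) (X := fun i x => c i * x)
      (fun i => ((memLp_id_gaussianReal (μ := 0) (v := 1) 2).const_mul (c i)))
    have e : (L : (ι → ℝ) → ℝ) = ∑ i, fun ω : ι → ℝ => c i * ω i := by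
      funext J; rw [hL]; simp
    rw [e, h]
    refine Finset.sum_congr rfl fun i _ => ?_
    rw [variance_const_mul, variance_fun_id_gaussianReal]
    simp
  have hpos : 0 < Var[L; stdGaussianPi ι] := by
    rw [hvar]
    obtain ⟨i, hi⟩ := Function.ne_iff.1 hc
    exact Finset.sum_pos' (fun i _ => sq_nonneg _) ⟨i, Finset.mem_univ i, by
      have : c i ≠ 0 := hi
      positivity⟩
  have hne : (Var[L; stdGaussianPi ι]).toNNReal ≠ 0 := by
    simpa using hpos
  have := nullSingletonClass_gaussianReal (μ := ∫ x, L x ∂(stdGaussianPi ι)) hne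
  have h0 : (stdGaussianPi ι).map L {0} = 0 := by rw [hmap]; exact measure_singleton _
  rw [Measure.map_apply (by fun_prop) (measurableSet_singleton _)] at h0
  convert h0 using 2
  ext J
  simp [hL]

/-- The event that the coordinates in `B` lie in prescribed sets. -/
def boxEvent (B : Finset ι) (I : ι → Set ℝ) : Set (ι → ℝ) :=
  {J | ∀ i ∈ B, J i ∈ I i}

theorem measurableSet_boxEvent (B : Finset ι) {I : ι → Set ℝ} (hI : ∀ i, MeasurableSet (I i)) :
    MeasurableSet (boxEvent B I) := by
  have : boxEvent B I = ⋂ i ∈ B, (fun J : ι → ℝ => J i) ⁻¹' I i := by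
    ext J; simp [boxEvent]
  rw [this]
  exact Finset.measurableSet_biInter _ fun i _ => measurable_pi_apply i (hI i)

theorem pow_card_le_measure_boxEvent (B : Finset ι) {I : ι → Set ℝ} {p : ENNReal}
    (hp : ∀ i ∈ B, p ≤ gaussianReal 0 1 (I i)) :
    p ^ B.card ≤ stdGaussianPi ι (boxEvent B I) := by
  classical
  have h : boxEvent B I = Set.univ.pi fun i => if i ∈ B then I i else Set.univ := by
    ext J
    simp only [boxEvent, Set.mem_ofPred_eq, Set.mem_pi, Set.mem_univ, true_imp_iff]
    refine forall_congr' fun i => ?_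
    split_ifs with hi <;> simp [hi]
  rw [h, Measure.pi_pi]
  have : ∀ i, gaussianReal 0 1 (if i ∈ B then I i else Set.univ) =
      if i ∈ B then gaussianReal 0 1 (I i) else 1 := by
    intro i; split_ifs <;> simp
  simp_rw [this]
  rw [Finset.prod_ite_mem, Finset.univ_inter, ← Finset.prod_const]
  exact Finset.prod_le_prod' hp

/-- Events supported on disjoint blocks of coordinates all fail with small probability. -/
theorem measure_iInter_compl_boxEvent_le {κ : Type*} (t : Finset κ) (B : κ → Finset ι)
    (I : κ → ι → Set ℝ) (hI : ∀ j i, MeasurableSet (I j i))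
    (hB : (t : Set κ).PairwiseDisjoint B) {q : ENNReal}
    (hq : ∀ j ∈ t, stdGaussianPi ι (boxEvent (B j) (I j))ᶜ ≤ q) :
    stdGaussianPi ι (⋂ j ∈ t, (boxEvent (B j) (I j))ᶜ) ≤ q ^ t.card := by
  classical
  induction t using Finset.induction_on with
  | empty => simp
  | insert j t hj ih =>
    rw [Finset.card_insert_of_notMem hj, pow_succ', Finset.set_biInter_insert]
    have hdisj : Disjoint (B j) (t.biUnion B) := by
      rw [Finset.disjoint_biUnion_right]
      intro i hi
      exact hB (by simp) (by simp [hi]) (by rintro rfl; exact hj hi)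
    have hind := iIndepFun.indepFun_finset (B j) (t.biUnion B) hdisj
      (iIndepFun_pi (μ := fun _ : ι => gaussianReal 0 1) (X := fun _ => id)
        fun _ => aemeasurable_id) (fun i => measurable_pi_apply i)
    have e₁ : (boxEvent (B j) (I j))ᶜ = (fun (J : ι → ℝ) (i : B j) => id (J i)) ⁻¹'
        (⋂ i : B j, (fun z : B j → ℝ => z i) ⁻¹' I j i)ᶜ := by
      ext J; simp [boxEvent]
    have e₂ : (⋂ l ∈ t, (boxEvent (B l) (I l))ᶜ) =
        (fun (J : ι → ℝ) (i : t.biUnion B) => id (J i)) ⁻¹'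
        (⋂ l ∈ t, (⋂ i : t.biUnion B, ⋂ (_ : i.1 ∈ B l),
          (fun z : ↥(t.biUnion B) → ℝ => z i) ⁻¹' I l i)ᶜ) := by
      ext J
      simp only [boxEvent, Set.mem_iInter, Set.mem_compl_iff, Set.mem_ofPred_eq, Set.mem_preimage,
        id]
      refine forall₂_congr fun l hl => not_congr ⟨fun h i hi => h i.1 hi, fun h i hi =>
        h ⟨i, Finset.mem_biUnion.2 ⟨l, hl, hi⟩⟩ hi⟩
    rw [e₁, e₂, hind.measure_inter_preimage_eq_mul _ _ ?_ ?_, ← e₁, ← e₂]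
    · refine mul_le_mul' (hq j (by simp)) (ih (hB.subset (by simp)) fun l hl => hq l (by simp [hl]))
    · exact (MeasurableSet.iInter fun i : B j => measurable_pi_apply i (hI j i)).compl
    · exact Finset.measurableSet_biInter _ fun l _ => (MeasurableSet.iInter fun i : ↥(t.biUnion B) =>
        MeasurableSet.iInter fun _ => measurable_pi_apply i (hI l i)).compl

/-- The tensor product of normalized Hermite polynomials. -/
noncomputable def hermitePi (k : ι → ℕ) (J : ι → ℝ) : ℝ := ∏ i, hermiteNormalized (k i) (J i)

theorem continuous_hermitePi (k : ι → ℕ) : Continuous (hermitePi k) :=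
  continuous_finsetProd _ fun i _ => (continuous_hermiteNormalized (k i)).comp (continuous_apply i)

theorem integral_hermitePi_mul (k l : ι → ℕ) :
    ∫ J, hermitePi k J * hermitePi l J ∂(stdGaussianPi ι) = if k = l then 1 else 0 := by
  classical
  simp only [hermitePi, ← Finset.prod_mul_distrib]
  rw [integral_fintype_prod_eq_prod
    (f := fun i x => hermiteNormalized (k i) x * hermiteNormalized (l i) x)]
  simp only [integral_hermiteNormalized_mul]
  split_ifs with h
  · simp [h]
  · obtain ⟨i, hi⟩ := Function.ne_iff.1 h
    exact Finset.prod_eq_zero (Finset.mem_univ i) (by simp [hi])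

theorem memLp_hermitePi (k : ι → ℕ) : MemLp (hermitePi k) 2 (stdGaussianPi ι) := by
  rw [memLp_two_iff_integrable_sq (continuous_hermitePi k).aestronglyMeasurable]
  have h := Integrable.fintype_prod (μ := fun _ : ι => gaussianReal 0 1)
    (f := fun i x => hermiteNormalized (k i) x * hermiteNormalized (k i) x)
    fun i => integrable_hermiteNormalized_mul (k i) (k i)
  refine h.congr (ae_of_all _ fun J => ?_)
  simp [hermitePi, sq, Finset.prod_mul_distrib]

theorem hermitePi_signs (k : ι → ℕ) (s : ι → ℤˣ) (J : ι → ℝ) :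
    hermitePi k (fun i => ((s i : ℤ) : ℝ) * J i) =
      (((∏ i, s i ^ k i : ℤˣ) : ℤ) : ℝ) * hermitePi k J := by
  simp only [hermitePi, Units.coe_prod, Int.cast_prod, ← Finset.prod_mul_distrib]
  refine Finset.prod_congr rfl fun i _ => ?_
  rcases Int.units_eq_one_or (s i) with h | h <;> simp [h, hermiteNormalized_neg]

/-- Bessel's inequality for the Hermite system; completeness is not needed, as only upper bounds on
spectral mass occur. -/
theorem sum_sq_integral_mul_hermitePi_le {g : (ι → ℝ) → ℝ} (hg : MemLp g 2 (stdGaussianPi ι))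
    (s : Finset (ι → ℕ)) :
    ∑ k ∈ s, (∫ J, g J * hermitePi k J ∂(stdGaussianPi ι)) ^ 2 ≤
      ∫ J, g J ^ 2 ∂(stdGaussianPi ι) := by
  classical
  have hinner : ∀ {a b : (ι → ℝ) → ℝ} (ha : MemLp a 2 (stdGaussianPi ι))
      (hb : MemLp b 2 (stdGaussianPi ι)),
      inner ℝ (ha.toLp a) (hb.toLp b) = ∫ J, b J * a J ∂(stdGaussianPi ι) := by
    intro a b ha hb
    rw [L2.inner_def]
    refine integral_congr_ae ?_
    filter_upwards [ha.coeFn_toLp, hb.coeFn_toLp] with J h₁ h₂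
    simp [h₁, h₂]
  have horth : Orthonormal ℝ fun k : ι → ℕ => (memLp_hermitePi k).toLp (hermitePi k) := by
    rw [orthonormal_iff_ite]
    intro k l
    rw [hinner, integral_hermitePi_mul]
    simp [eq_comm]
  have h := horth.sum_inner_products_le (s := s) (hg.toLp g)
  rw [← real_inner_self_eq_norm_sq, hinner] at h
  simp only [hinner, Real.norm_eq_abs, sq_abs] at h
  simpa [sq] using h

theorem tsum_sq_integral_mul_hermitePi_le {g : (ι → ℝ) → ℝ} (hg : MemLp g 2 (stdGaussianPi ι))
    (K : Set (ι → ℕ)) :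
    ∑' k : K, ENNReal.ofReal ((∫ J, g J * hermitePi k.1 J ∂(stdGaussianPi ι)) ^ 2) ≤
      ENNReal.ofReal (∫ J, g J ^ 2 ∂(stdGaussianPi ι)) := by
  classical
  rw [ENNReal.tsum_eq_iSup_sum]
  refine iSup_le fun s => ?_
  rw [← ENNReal.ofReal_sum_of_nonneg fun _ _ => sq_nonneg _]
  refine ENNReal.ofReal_le_ofReal ?_
  have h := sum_sq_integral_mul_hermitePi_le hg (s.map (Function.Embedding.subtype _))
  simpa using h

end Product

/-! ### Ground states: gauge symmetry, almost sure uniqueness, dominant edges. -/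

section GroundStates

variable {V : Type*} [Fintype V] [DecidableEq V] (G : SimpleGraph V) [DecidableRel G.Adj]

/-- The product `σ_x σ_y` over the endpoints of an edge. -/
def edgeSpin (σ : V → ℤˣ) (e : G.edgeSet) : ℤˣ := (e.1.map σ).mul

theorem edgeSpin_mk (σ : V → ℤˣ) {x y : V} (h : G.Adj x y) :
    edgeSpin G σ ⟨s(x, y), h⟩ = σ x * σ y := rfl

theorem edgeSpin_mul (η σ : V → ℤˣ) (e : G.edgeSet) :
    edgeSpin G (η * σ) e = edgeSpin G η e * edgeSpin G σ e := by
  obtain ⟨e, he⟩ := e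
  induction e using Sym2.ind with
  | _ x y =>
    change η x * σ x * (η y * σ y) = η x * η y * (σ x * σ y)
    exact mul_mul_mul_comm _ _ _ _

theorem hamiltonian_eq (J : G.edgeSet → ℝ) (σ : V → ℤˣ) :
    hamiltonian G J σ = ∑ e, J e * ((edgeSpin G σ e : ℤ) : ℝ) := rfl

theorem intUnit_cast_mul_self (s : ℤˣ) : ((s : ℤ) : ℝ) * ((s : ℤ) : ℝ) = 1 := by
  rcases Int.units_eq_one_or s with h | h <;> simp [h]

theorem abs_intUnit_cast (s : ℤˣ) : |((s : ℤ) : ℝ)| = 1 := by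
  rcases Int.units_eq_one_or s with h | h <;> simp [h]

/-- The action of a gauge transformation on the couplings. -/
noncomputable def gauge (η : V → ℤˣ) (J : G.edgeSet → ℝ) (e : G.edgeSet) : ℝ :=
  ((edgeSpin G η e : ℤ) : ℝ) * J e

theorem hamiltonian_gauge (η σ : V → ℤˣ) (J : G.edgeSet → ℝ) :
    hamiltonian G (gauge G η J) (η * σ) = hamiltonian G J σ := by
  simp only [hamiltonian_eq, edgeSpin_mul, gauge]
  refine Finset.sum_congr rfl fun e _ => ?_
  push_cast
  linear_combination J e * ((edgeSpin G σ e : ℤ) : ℝ) * intUnit_cast_mul_self (edgeSpin G η e)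

theorem IsGroundState.gauge {J : G.edgeSet → ℝ} {σ : V → ℤˣ} (h : IsGroundState G J σ)
    (η : V → ℤˣ) : IsGroundState G (gauge G η J) (η * σ) := by
  intro τ
  have hτ : τ = η * (η⁻¹ * τ) := by rw [mul_inv_cancel_left]
  rw [hτ, hamiltonian_gauge, hamiltonian_gauge]
  exact h _

theorem isGroundState_groundState (J : G.edgeSet → ℝ) : IsGroundState G J (groundState G J) :=
  Classical.choose_spec (exists_isGroundState G J)

/-- The choice depends only on the predicate of being a ground state, so equal sets of ground states
give the same chosen one, with no appeal to uniqueness. -/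
theorem groundState_congr {J J' : G.edgeSet → ℝ}
    (h : ∀ σ, IsGroundState G J σ ↔ IsGroundState G J' σ) :
    groundState G J = groundState G J' := by
  have e : IsGroundState G J = IsGroundState G J' := funext fun σ => propext (h σ)
  unfold groundState
  congr 1

theorem exists_edgeSpin_ne {u v : V} (huv : G.Reachable u v) {σ τ : V → ℤˣ}
    (h : σ u * σ v ≠ τ u * τ v) : ∃ e, edgeSpin G σ e ≠ edgeSpin G τ e := by
  by_contra! hall
  apply h
  obtain ⟨w⟩ := huv
  clear h
  induction w with
  | nil => simp
  | @cons a b c hab _ ih =>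
    have h₁ := hall ⟨s(a, b), hab⟩
    rw [edgeSpin_mk, edgeSpin_mk] at h₁
    have e : ∀ ρ : V → ℤˣ, ρ a * ρ c = (ρ a * ρ b) * (ρ b * ρ c) := fun ρ => by
      rw [mul_assoc, ← mul_assoc (ρ b), Int.units_mul_self, one_mul]
    rw [e σ, e τ, h₁, ih]

/-- The relative spin does not depend on the ground state, almost surely. -/
theorem ae_relativeSpin_unique {u v : V} (huv : G.Reachable u v) :
    ∀ᵐ J ∂(couplingLaw G), ∀ σ τ, IsGroundState G J σ → IsGroundState G J τ →
      σ u * σ v = τ u * τ v := by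
  rw [ae_all_iff]
  intro σ
  rw [ae_all_iff]
  intro τ
  by_cases h : σ u * σ v = τ u * τ v
  · exact ae_of_all _ fun _ _ _ => h
  obtain ⟨e, he⟩ := exists_edgeSpin_ne G huv h
  have hnull := measure_hyperplane_eq_zero
    (fun e : G.edgeSet => ((edgeSpin G σ e : ℤ) : ℝ) - ((edgeSpin G τ e : ℤ) : ℝ)) (by
      intro h0
      have := congrFun h0 e
      simp only [Pi.zero_apply, sub_eq_zero, Int.cast_inj, Units.val_inj] at this
      exact he this)
  filter_upwards [measure_eq_zero_iff_ae_notMem.1 hnull] with J hJ hσ hτ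
  exfalso
  apply hJ
  have := le_antisymm (hσ τ) (hτ σ)
  rw [hamiltonian_eq, hamiltonian_eq] at this
  change ∑ e, _ = (0 : ℝ)
  simp only [sub_mul, Finset.sum_sub_distrib]
  simp only [mul_comm (J _)] at this
  rw [this, sub_self]

theorem relativeSpin_eq_of_unique {u v : V} {J : G.edgeSet → ℝ}
    (hJ : ∀ σ τ, IsGroundState G J σ → IsGroundState G J τ → σ u * σ v = τ u * τ v)
    {σ : V → ℤˣ} (hσ : IsGroundState G J σ) :
    relativeSpin G u v J = ((σ u * σ v : ℤˣ) : ℤ) := by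
  unfold relativeSpin
  rw [hJ _ _ (isGroundState_groundState G J) hσ]

theorem ae_relativeSpin_gauge {u v : V} (huv : G.Reachable u v) (η : V → ℤˣ) :
    ∀ᵐ J ∂(couplingLaw G), relativeSpin G u v (gauge G η J) =
      (((η u * η v : ℤˣ) : ℤ) : ℝ) * relativeSpin G u v J := by
  have h' := (measurePreserving_signs (edgeSpin G η)).quasiMeasurePreserving.ae
    (ae_relativeSpin_unique G huv)
  filter_upwards [h'] with J hJ
  have hσ := isGroundState_groundState G J
  rw [relativeSpin_eq_of_unique G (J := gauge G η J) hJ (hσ.gauge G η)]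
  simp only [relativeSpin, Pi.mul_apply]
  push_cast
  ring

theorem isClosed_setOf_isGroundState (σ : V → ℤˣ) : IsClosed {J | IsGroundState G J σ} := by
  simp only [IsGroundState, Set.ofPred_forall]
  refine isClosed_iInter fun τ => isClosed_le ?_ ?_ <;>
  · simp only [hamiltonian_eq]
    fun_prop

/-- The chosen ground state has no evident measurability. By almost sure uniqueness, the relative
spin agrees a.e. with the sign determined by a finite union of closed sets. -/
theorem aestronglyMeasurable_relativeSpin {u v : V} (huv : G.Reachable u v) :
    AEStronglyMeasurable (relativeSpin G u v) (couplingLaw G) := by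
  classical
  let A : Set (G.edgeSet → ℝ) :=
    ⋃ σ ∈ {σ : V → ℤˣ | σ u * σ v = 1}, {J | IsGroundState G J σ}
  have hA : MeasurableSet A := MeasurableSet.biUnion (Set.to_countable _)
    fun σ _ => (isClosed_setOf_isGroundState G σ).measurableSet
  refine ⟨fun J => if J ∈ A then 1 else -1, ?_, ?_⟩
  · exact (Measurable.ite hA measurable_const measurable_const).stronglyMeasurable
  · filter_upwards [ae_relativeSpin_unique G huv] with J hJ
    split_ifs with h
    · simp only [A, Set.mem_iUnion] at h
      obtain ⟨σ, hσ, hJσ⟩ := h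
      rw [relativeSpin_eq_of_unique G hJ hJσ, show σ u * σ v = 1 from hσ]
      simp
    · have hg := isGroundState_groundState G J
      rw [relativeSpin_eq_of_unique G hJ hg]
      rcases Int.units_eq_one_or (groundState G J u * groundState G J v) with h1 | h1
      · exact absurd (Set.mem_biUnion (x := groundState G J) h1 hg) h
      · rw [h1]; simp

theorem abs_relativeSpin (u v : V) (J : G.edgeSet → ℝ) : |relativeSpin G u v J| = 1 :=
  abs_intUnit_cast _

theorem memLp_indicator_relativeSpin {u v : V} (huv : G.Reachable u v)
    {A : Set (G.edgeSet → ℝ)} (hA : MeasurableSet A) :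
    MemLp (A.indicator (relativeSpin G u v)) 2 (couplingLaw G) := by
  have : IsProbabilityMeasure (couplingLaw G) := by unfold couplingLaw; infer_instance
  refine MemLp.of_bound ((aestronglyMeasurable_relativeSpin G huv).indicator hA) 1
    (ae_of_all _ fun J => ?_)
  by_cases h : J ∈ A <;> simp [h, abs_relativeSpin]

theorem fourierCoeff_eq (u v : V) (k : G.edgeSet → ℕ) :
    fourierCoeff G u v k =
      ∫ J, relativeSpin G u v J * hermitePi k J ∂(stdGaussianPi G.edgeSet) := rfl

/-- The subgraph of the edges on which the multi-index `k` is odd. -/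
def oddGraph (k : G.edgeSet → ℕ) : SimpleGraph V :=
  SimpleGraph.fromEdgeSet {e | ∃ h : e ∈ G.edgeSet, Odd (k ⟨e, h⟩)}

theorem oddGraph_adj {k : G.edgeSet → ℕ} {x y : V} :
    (oddGraph G k).Adj x y ↔ ∃ h : G.Adj x y, Odd (k ⟨s(x, y), h⟩) := by
  simp only [oddGraph, SimpleGraph.fromEdgeSet_adj]
  constructor
  · rintro ⟨⟨h, h'⟩, -⟩
    exact ⟨h, h'⟩
  · rintro ⟨h, h'⟩
    exact ⟨⟨h, h'⟩, h.ne⟩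

/-- By gauge symmetry, only multi-indices whose odd edges connect `u` to `v` contribute. -/
theorem reachable_oddGraph {u v : V} (huv : G.Reachable u v) {k : G.edgeSet → ℕ}
    (hk : fourierCoeff G u v k ≠ 0) : (oddGraph G k).Reachable u v := by
  classical
  by_contra hnot
  -- Flip the odd component of `u`: no odd edge is cut, so `hermitePi k` is invariant, while `σ_u
  -- σ_v` changes sign.
  let η : V → ℤˣ := fun x => if (oddGraph G k).Reachable u x then -1 else 1
  have hη : ∀ e, edgeSpin G η e ^ k e = 1 := by
    rintro ⟨e, he⟩
    induction e using Sym2.ind with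
    | _ x y =>
      rcases Nat.even_or_odd (k ⟨s(x, y), he⟩) with hev | hodd
      · exact hev.elim fun m hm => by rw [hm, ← two_mul, pow_mul, sq, Int.units_mul_self, one_pow]
      · have hadj : (oddGraph G k).Adj x y := (oddGraph_adj G).2 ⟨he, hodd⟩
        have hiff : (oddGraph G k).Reachable u x ↔ (oddGraph G k).Reachable u y :=
          ⟨fun h => h.trans hadj.reachable, fun h => h.trans hadj.symm.reachable⟩
        have : η x = η y := by simp only [η, hiff]
        have e1 : edgeSpin G η ⟨s(x, y), he⟩ = 1 := by
          rw [show edgeSpin G η ⟨s(x, y), he⟩ = η x * η y from rfl, this, Int.units_mul_self]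
        rw [e1, one_pow]
  have hu : η u = -1 := by simp [η]
  have hv : η v = 1 := by simp [η, hnot]
  have h := integral_comp_signs (edgeSpin G η)
    (fun J => relativeSpin G u v J * hermitePi k J)
  have h2 : ∫ J, relativeSpin G u v (fun e => ((edgeSpin G η e : ℤ) : ℝ) * J e) *
      hermitePi k (fun e => ((edgeSpin G η e : ℤ) : ℝ) * J e) ∂(stdGaussianPi G.edgeSet) =
      -∫ J, relativeSpin G u v J * hermitePi k J ∂(stdGaussianPi G.edgeSet) := by
    rw [← integral_neg]
    refine integral_congr_ae ?_
    filter_upwards [ae_relativeSpin_gauge G huv η] with J hJ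
    rw [hermitePi_signs]
    change relativeSpin G u v (gauge G η J) * _ = _
    rw [hJ, hu, hv]
    simp [hη]
  rw [h2] at h
  rw [fourierCoeff_eq] at hk
  exact hk (by linarith)

/-- An edge that dominates the other boundary edges of a region is satisfied in every ground
state. The region is encoded by the sign `η`. -/
theorem IsGroundState.dominant_edge {J : G.edgeSet → ℝ} {σ : V → ℤˣ} (h : IsGroundState G J σ)
    (η : V → ℤˣ) (e₀ : G.edgeSet) (he₀ : edgeSpin G η e₀ = -1)
    (hdom : ∑ e with edgeSpin G η e = -1 ∧ e ≠ e₀, |J e| < |J e₀|) :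
    0 < J e₀ * ((edgeSpin G σ e₀ : ℤ) : ℝ) := by
  classical
  -- Flipping the region changes the energy by minus twice the boundary sum, which is therefore
  -- nonnegative; an unsatisfied dominant edge would make it negative.
  have h1 := h (η * σ)
  simp only [hamiltonian_eq, edgeSpin_mul] at h1
  have h2 : 0 ≤ ∑ e, if edgeSpin G η e = -1 then J e * ((edgeSpin G σ e : ℤ) : ℝ) else 0 := by
    have : ∀ e, (if edgeSpin G η e = -1 then J e * ((edgeSpin G σ e : ℤ) : ℝ) else 0) =
        (J e * ((edgeSpin G σ e : ℤ) : ℝ) -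
          J e * (((edgeSpin G η e * edgeSpin G σ e : ℤˣ) : ℤ) : ℝ)) / 2 := by
      intro e
      rcases Int.units_eq_one_or (edgeSpin G η e) with hs | hs
      · rw [hs, if_neg (by decide)]; simp
      · rw [hs, if_pos rfl]; push_cast; ring
    simp only [this]
    rw [← Finset.sum_div, Finset.sum_sub_distrib]
    linarith
  rw [← Finset.sum_filter, ← Finset.add_sum_erase _ _ (by simpa using he₀ :
    e₀ ∈ Finset.univ.filter fun e => edgeSpin G η e = -1)] at h2
  have h3 : ∑ e ∈ (Finset.univ.filter fun e => edgeSpin G η e = -1).erase e₀,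
      J e * ((edgeSpin G σ e : ℤ) : ℝ) ≤ ∑ e with edgeSpin G η e = -1 ∧ e ≠ e₀, |J e| := by
    have hset : (Finset.univ.filter fun e => edgeSpin G η e = -1).erase e₀ =
        Finset.univ.filter fun e => edgeSpin G η e = -1 ∧ e ≠ e₀ := by
      ext e; simp [and_comm]
    rw [hset]
    refine Finset.sum_le_sum fun e _ => (le_abs_self _).trans ?_
    rw [abs_mul, abs_intUnit_cast, mul_one]
  have h4 : |J e₀ * ((edgeSpin G σ e₀ : ℤ) : ℝ)| = |J e₀| := by
    rw [abs_mul, abs_intUnit_cast, mul_one]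
  by_contra hneg
  rw [abs_of_nonpos (not_lt.1 hneg)] at h4
  linarith

end GroundStates

/-! ### Shielded squares and the decay of coefficients odd on many of their edges. -/

section Squares

variable {V : Type*} [Fintype V] [DecidableEq V] (G : SimpleGraph V) [DecidableRel G.Adj]

/-- A four-cycle `a b d c` in the graph `G`. -/
structure FourCycle where
  (a b c d : V)
  hab : G.Adj a b
  hac : G.Adj a c
  hbd : G.Adj b d
  hcd : G.Adj c d
  had : a ≠ d
  hbc : b ≠ c

namespace FourCycle

variable {G} (Q : FourCycle G)

/-- The edge `ab`. -/
def ab : G.edgeSet := ⟨s(Q.a, Q.b), Q.hab⟩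

/-- The edge `ac`. -/
def ac : G.edgeSet := ⟨s(Q.a, Q.c), Q.hac⟩

/-- The edge `bd`. -/
def bd : G.edgeSet := ⟨s(Q.b, Q.d), Q.hbd⟩

/-- The edge `cd`. -/
def cd : G.edgeSet := ⟨s(Q.c, Q.d), Q.hcd⟩

/-- The edges touching the cycle. -/
def block : Finset G.edgeSet := {e | Q.a ∈ e.1 ∨ Q.b ∈ e.1 ∨ Q.c ∈ e.1 ∨ Q.d ∈ e.1}

/-- The couplings on `ac`, `cd`, `bd` are required to be strong, the others weak. -/
def range (e : G.edgeSet) : Set ℝ :=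
  if e = Q.ac ∨ e = Q.bd ∨ e = Q.cd then {x | 16 < |x|} else {x | |x| ≤ 1}

/-- The event that `ac`, `cd`, `bd` are strong and all other edges touching the cycle are weak. -/
def shieldEvent : Set (G.edgeSet → ℝ) := boxEvent Q.block Q.range

theorem measurableSet_range (e : G.edgeSet) : MeasurableSet (Q.range e) := by
  unfold range
  split_ifs
  · exact measurableSet_lt measurable_const (by fun_prop)
  · exact measurableSet_le (by fun_prop) measurable_const

theorem measurableSet_shieldEvent : MeasurableSet Q.shieldEvent :=
  measurableSet_boxEvent _ Q.measurableSet_range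

theorem mem_shieldEvent_congr {J J' : G.edgeSet → ℝ} (h : ∀ e, |J e| = |J' e|) :
    J ∈ Q.shieldEvent ↔ J' ∈ Q.shieldEvent := by
  refine forall₂_congr fun e _ => ?_
  unfold range
  split_ifs <;> simp [h e]

theorem card_block_le (hdeg : ∀ x, G.degree x ≤ 4) : Q.block.card ≤ 16 := by
  have hstar : ∀ x, (Finset.univ.filter fun e : G.edgeSet => x ∈ e.1).card ≤ 4 := by
    intro x
    refine le_trans ?_ (hdeg x)
    rw [← G.card_incidenceFinset_eq_degree x]
    refine Finset.card_le_card_of_injOn (fun e => e.1) (fun e he => ?_)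
      (Subtype.val_injective.injOn)
    rw [Finset.mem_coe, SimpleGraph.mem_incidenceFinset]
    exact ⟨e.2, (Finset.mem_filter.1 he).2⟩
  have hsub : Q.block ⊆ (Finset.univ.filter fun e : G.edgeSet => Q.a ∈ e.1) ∪
      ((Finset.univ.filter fun e : G.edgeSet => Q.b ∈ e.1) ∪
      ((Finset.univ.filter fun e : G.edgeSet => Q.c ∈ e.1) ∪
      (Finset.univ.filter fun e : G.edgeSet => Q.d ∈ e.1))) := by
    intro e he
    simpa [block] using he
  have h1 := Finset.card_le_card hsub
  have h2 := Finset.card_union_le (Finset.univ.filter fun e : G.edgeSet => Q.a ∈ e.1)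
    ((Finset.univ.filter fun e : G.edgeSet => Q.b ∈ e.1) ∪
      ((Finset.univ.filter fun e : G.edgeSet => Q.c ∈ e.1) ∪
      (Finset.univ.filter fun e : G.edgeSet => Q.d ∈ e.1)))
  have h3 := Finset.card_union_le (Finset.univ.filter fun e : G.edgeSet => Q.b ∈ e.1)
      ((Finset.univ.filter fun e : G.edgeSet => Q.c ∈ e.1) ∪
      (Finset.univ.filter fun e : G.edgeSet => Q.d ∈ e.1))
  have h4 := Finset.card_union_le (Finset.univ.filter fun e : G.edgeSet => Q.c ∈ e.1)
      (Finset.univ.filter fun e : G.edgeSet => Q.d ∈ e.1)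
  have := hstar Q.a
  have := hstar Q.b
  have := hstar Q.c
  have := hstar Q.d
  omega

/-- A strong edge is satisfied if it is the only strong edge in the boundary of a region of which
every boundary edge touches the cycle. -/
theorem strong_edge_satisfied (hdeg : ∀ x, G.degree x ≤ 4) {J : G.edgeSet → ℝ}
    (hJ : J ∈ Q.shieldEvent) {σ : V → ℤˣ} (hσ : IsGroundState G J σ) (η : V → ℤˣ)
    (e₀ : G.edgeSet) (he₀ : edgeSpin G η e₀ = -1)
    (hstrong : e₀ = Q.ac ∨ e₀ = Q.bd ∨ e₀ = Q.cd)
    (hη : ∀ e, edgeSpin G η e = -1 → e ∈ Q.block)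
    (hother : ∀ e, edgeSpin G η e = -1 → (e = Q.ac ∨ e = Q.bd ∨ e = Q.cd) → e = e₀) :
    0 < J e₀ * ((edgeSpin G σ e₀ : ℤ) : ℝ) := by
  refine hσ.dominant_edge G η e₀ he₀ ?_
  have h0 : 16 < |J e₀| := by
    have := hJ e₀ (hη e₀ he₀)
    rwa [range, if_pos hstrong] at this
  refine lt_of_le_of_lt ?_ h0
  calc ∑ e with edgeSpin G η e = -1 ∧ e ≠ e₀, |J e|
      ≤ ∑ e with edgeSpin G η e = -1 ∧ e ≠ e₀, (1 : ℝ) := by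
        refine Finset.sum_le_sum fun e he => ?_
        obtain ⟨-, h1, h2⟩ := Finset.mem_filter.1 he
        have := hJ e (hη e h1)
        rwa [range, if_neg fun h => h2 (hother e h1 h)] at this
    _ ≤ (Q.block.card : ℝ) := by
        rw [Finset.sum_const, nsmul_eq_mul, mul_one]
        refine Nat.cast_le.2 (Finset.card_le_card fun e he => ?_)
        exact hη e (Finset.mem_filter.1 he).2.1
    _ ≤ 16 := by exact_mod_cast Q.card_block_le hdeg

/-- The spin flip of a set of vertices. -/
def flipSign (A : Finset V) (x : V) : ℤˣ := if x ∈ A then -1 else 1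

theorem edgeSpin_flipSign {A : Finset V} {x y : V} (h : G.Adj x y) :
    edgeSpin G (flipSign A) ⟨s(x, y), h⟩ = -1 ↔ (x ∈ A ∧ y ∉ A) ∨ (x ∉ A ∧ y ∈ A) := by
  rw [edgeSpin_mk]
  unfold flipSign
  by_cases hx : x ∈ A <;> by_cases hy : y ∈ A <;> simp [hx, hy]

theorem exists_mem_of_edgeSpin_flipSign {A : Finset V} {e : G.edgeSet}
    (h : edgeSpin G (flipSign A) e = -1) : ∃ x ∈ A, x ∈ e.1 := by
  obtain ⟨e, he⟩ := e
  induction e using Sym2.ind with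
  | _ x y =>
    rcases (edgeSpin_flipSign he).1 h with h | h
    · exact ⟨x, h.1, Sym2.mem_mk_left x y⟩
    · exact ⟨y, h.2, Sym2.mem_mk_right x y⟩

/-- The cuts around `{a}`, `{b}` and `{a, c}` each contain exactly one strong edge: `ac`, `bd` and
`cd` respectively. All three are thus satisfied, and their couplings agree in `J` and `J'`. The spin
product on `ab` is the product of these three. -/
theorem edgeSpin_ab_eq (hdeg : ∀ x, G.degree x ≤ 4) {J J' : G.edgeSet → ℝ}
    (hJ : J ∈ Q.shieldEvent) (hJ' : J' ∈ Q.shieldEvent) (heq : ∀ e, e ≠ Q.ab → J e = J' e)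
    {σ τ : V → ℤˣ} (hσ : IsGroundState G J σ) (hτ : IsGroundState G J' τ) :
    edgeSpin G σ Q.ab = edgeSpin G τ Q.ab := by
  have nab := Q.hab.ne
  have nac := Q.hac.ne
  have nbd := Q.hbd.ne
  have ncd := Q.hcd.ne
  have nad := Q.had
  have nbc := Q.hbc
  have key : ∀ (A : Finset V) (e₀ : G.edgeSet), e₀ ≠ Q.ab →
      edgeSpin G (flipSign A) e₀ = -1 → (e₀ = Q.ac ∨ e₀ = Q.bd ∨ e₀ = Q.cd) →
      (∀ x ∈ A, x = Q.a ∨ x = Q.b ∨ x = Q.c ∨ x = Q.d) →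
      (∀ e, edgeSpin G (flipSign A) e = -1 → (e = Q.ac ∨ e = Q.bd ∨ e = Q.cd) → e = e₀) →
      edgeSpin G σ e₀ = edgeSpin G τ e₀ := by
    intro A e₀ hne he₀ hs hA hother
    have hη : ∀ e, edgeSpin G (flipSign A) e = -1 → e ∈ Q.block := by
      intro e he
      obtain ⟨x, hx, hxe⟩ := exists_mem_of_edgeSpin_flipSign he
      rw [block, Finset.mem_filter]
      refine ⟨Finset.mem_univ _, ?_⟩
      rcases hA x hx with rfl | rfl | rfl | rfl <;> simp [hxe]
    have h1 := Q.strong_edge_satisfied hdeg hJ hσ (flipSign A) e₀ he₀ hs hη hother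
    have h2 := Q.strong_edge_satisfied hdeg hJ' hτ (flipSign A) e₀ he₀ hs hη hother
    rw [← heq e₀ hne] at h2
    rcases Int.units_eq_one_or (edgeSpin G σ e₀) with ha | ha <;>
    rcases Int.units_eq_one_or (edgeSpin G τ e₀) with hb | hb <;>
    · rw [ha, hb]
      try
        exfalso
        rw [ha] at h1
        rw [hb] at h2
        push_cast at h1 h2
        linarith
  have h1 : edgeSpin G σ Q.ac = edgeSpin G τ Q.ac := by
    refine key {Q.a} Q.ac ?_ ?_ (by simp) (by simp) ?_
    · exact fun h => by simpa [ac, ab, nbc.symm, nab] using congrArg Subtype.val h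
    · rw [ac, edgeSpin_flipSign]; simp [nac.symm]
    · rintro e he (rfl | rfl | rfl)
      · rfl
      · rw [bd, edgeSpin_flipSign] at he; simp [nab.symm, nad.symm] at he
      · rw [cd, edgeSpin_flipSign] at he; simp [nac.symm, nad.symm] at he
  have h2 : edgeSpin G σ Q.bd = edgeSpin G τ Q.bd := by
    refine key {Q.b} Q.bd ?_ ?_ (by simp) (by simp) ?_
    · exact fun h => by simpa [bd, ab, nad.symm, nab.symm] using congrArg Subtype.val h
    · rw [bd, edgeSpin_flipSign]; simp [nbd.symm]
    · rintro e he (rfl | rfl | rfl)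
      · rw [ac, edgeSpin_flipSign] at he; simp [nab, nbc.symm] at he
      · rfl
      · rw [cd, edgeSpin_flipSign] at he; simp [nbd.symm, nbc.symm] at he
  have h3 : edgeSpin G σ Q.cd = edgeSpin G τ Q.cd := by
    refine key {Q.a, Q.c} Q.cd ?_ ?_ (by simp) (by simp) ?_
    · exact fun h => by simpa [cd, ab, nac.symm, nbc.symm] using congrArg Subtype.val h
    · rw [cd, edgeSpin_flipSign]; simp [ncd.symm, nad.symm]
    · rintro e he (rfl | rfl | rfl)
      · rw [ac, edgeSpin_flipSign] at he; simp at he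
      · rw [bd, edgeSpin_flipSign] at he; simp [nab.symm, nbc, nad.symm, ncd.symm] at he
      · rfl
  have hprod : ∀ ρ : V → ℤˣ, edgeSpin G ρ Q.ab =
      edgeSpin G ρ Q.ac * edgeSpin G ρ Q.cd * edgeSpin G ρ Q.bd := by
    intro ρ
    change ρ Q.a * ρ Q.b = ρ Q.a * ρ Q.c * (ρ Q.c * ρ Q.d) * (ρ Q.b * ρ Q.d)
    rcases Int.units_eq_one_or (ρ Q.c) with hc | hc <;>
    rcases Int.units_eq_one_or (ρ Q.d) with hd | hd <;> simp [hc, hd]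
  rw [hprod, hprod, h1, h2, h3]

/-- The two energies differ by a multiple of the spin product on `ab`, on which all ground states of
both agree, so the maximizers coincide. -/
theorem isGroundState_of_shielded (hdeg : ∀ x, G.degree x ≤ 4) {J J' : G.edgeSet → ℝ}
    (hJ : J ∈ Q.shieldEvent) (hJ' : J' ∈ Q.shieldEvent) (heq : ∀ e, e ≠ Q.ab → J e = J' e)
    {σ : V → ℤˣ} (hσ : IsGroundState G J σ) : IsGroundState G J' σ := by
  obtain ⟨τ, hτ⟩ := exists_isGroundState G J'
  have hab := Q.edgeSpin_ab_eq hdeg hJ hJ' heq hσ hτ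
  have hdiff : ∀ ρ, hamiltonian G J' ρ =
      hamiltonian G J ρ + (J' Q.ab - J Q.ab) * ((edgeSpin G ρ Q.ab : ℤ) : ℝ) := by
    intro ρ
    simp only [hamiltonian_eq]
    rw [← Finset.add_sum_erase _ _ (Finset.mem_univ Q.ab),
      ← Finset.add_sum_erase (a := Q.ab) _ (fun e => J e * _) (Finset.mem_univ Q.ab)]
    have : ∑ e ∈ Finset.univ.erase Q.ab, J' e * ((edgeSpin G ρ e : ℤ) : ℝ) =
        ∑ e ∈ Finset.univ.erase Q.ab, J e * ((edgeSpin G ρ e : ℤ) : ℝ) :=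
      Finset.sum_congr rfl fun e he => by rw [heq e (Finset.ne_of_mem_erase he)]
    rw [this]
    ring
  intro ρ
  refine (hτ ρ).trans ?_
  rw [hdiff τ, hdiff σ, hab]
  have := hσ τ
  linarith

/-- The sign change of the coupling on `ab`. -/
def abSign (e : G.edgeSet) : ℤˣ := if e = Q.ab then -1 else 1

theorem relativeSpin_abSign (hdeg : ∀ x, G.degree x ≤ 4) (u v : V) {J : G.edgeSet → ℝ}
    (hJ : J ∈ Q.shieldEvent) :
    relativeSpin G u v (fun e => ((Q.abSign e : ℤ) : ℝ) * J e) = relativeSpin G u v J := by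
  have habs : ∀ e, |J e| = |((Q.abSign e : ℤ) : ℝ) * J e| := fun e => by
    rw [abs_mul, abs_intUnit_cast, one_mul]
  have hJ' := (Q.mem_shieldEvent_congr habs).1 hJ
  have heq : ∀ e, e ≠ Q.ab → J e = ((Q.abSign e : ℤ) : ℝ) * J e := by
    intro e he
    simp [abSign, he]
  unfold relativeSpin
  rw [groundState_congr G fun σ =>
    ⟨fun h => Q.isGroundState_of_shielded hdeg hJ' hJ (fun e he => (heq e he).symm) h,
      fun h => Q.isGroundState_of_shielded hdeg hJ hJ' heq h⟩]

/-- Under `J_ab ↦ -J_ab` the event and the relative spin on it are invariant, while `hermitePi k` is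
odd. -/
theorem integral_shielded_eq_zero (hdeg : ∀ x, G.degree x ≤ 4) (u v : V) {k : G.edgeSet → ℕ}
    (hk : Odd (k Q.ab)) {A : Set (G.edgeSet → ℝ)}
    (hA : ∀ J, (fun e => ((Q.abSign e : ℤ) : ℝ) * J e) ∈ A ↔ J ∈ A) :
    ∫ J, (A ∩ Q.shieldEvent).indicator (relativeSpin G u v) J * hermitePi k J
      ∂(stdGaussianPi G.edgeSet) = 0 := by
  have hprod : ∏ e, Q.abSign e ^ k e = -1 := by
    rw [Finset.prod_eq_single Q.ab]
    · simp [abSign, hk.neg_one_pow]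
    · intro e _ he; simp [abSign, he]
    · simp
  have h := integral_comp_signs Q.abSign
    (fun J => (A ∩ Q.shieldEvent).indicator (relativeSpin G u v) J * hermitePi k J)
  have hfun : (fun J : G.edgeSet → ℝ => (A ∩ Q.shieldEvent).indicator (relativeSpin G u v)
      (fun e => ((Q.abSign e : ℤ) : ℝ) * J e) *
        hermitePi k (fun e => ((Q.abSign e : ℤ) : ℝ) * J e)) =
      fun J => -((A ∩ Q.shieldEvent).indicator (relativeSpin G u v) J * hermitePi k J) := by
    funext J
    rw [hermitePi_signs, hprod]
    have hmem : (fun e => ((Q.abSign e : ℤ) : ℝ) * J e) ∈ Q.shieldEvent ↔ J ∈ Q.shieldEvent :=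
      Q.mem_shieldEvent_congr fun e => by rw [abs_mul, abs_intUnit_cast, one_mul]
    by_cases hJ : J ∈ A ∩ Q.shieldEvent
    · rw [Set.indicator_of_mem hJ,
        Set.indicator_of_mem (show _ ∈ A ∩ Q.shieldEvent from ⟨(hA J).2 hJ.1, hmem.2 hJ.2⟩),
        Q.relativeSpin_abSign hdeg u v hJ.2]
      simp
    · rw [Set.indicator_of_notMem hJ, Set.indicator_of_notMem fun h' =>
        hJ ⟨(hA J).1 h'.1, hmem.1 h'.2⟩]
      simp
  rw [hfun, integral_neg] at h
  linarith

end FourCycle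

variable {G}

/-- Shielded configurations do not contribute to the Fourier coefficients that are odd on all
the protected edges. -/
theorem fourierCoeff_eq_integral_indicator (hdeg : ∀ x, G.degree x ≤ 4) {u v : V}
    (huv : G.Reachable u v) {κ : Type*} (t : Finset κ) (Q : κ → FourCycle G) {k : G.edgeSet → ℕ}
    (hk : ∀ j ∈ t, Odd (k (Q j).ab)) :
    fourierCoeff G u v k =
      ∫ J, (⋂ j ∈ t, ((Q j).shieldEvent)ᶜ).indicator (relativeSpin G u v) J * hermitePi k J
        ∂(stdGaussianPi G.edgeSet) := by
  classical
  induction t using Finset.induction_on with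
  | empty => simp [fourierCoeff_eq]
  | insert j t hj ih =>
    rw [ih fun i hi => hk i (by simp [hi]), Finset.set_biInter_insert]
    set A : Set (G.edgeSet → ℝ) := ⋂ j ∈ t, ((Q j).shieldEvent)ᶜ with hAdef
    have hAm : MeasurableSet A :=
      Finset.measurableSet_biInter _ fun i _ => (Q i).measurableSet_shieldEvent.compl
    -- Shield events depend only on absolute values, so those already excluded survive the sign
    -- change at the next square.
    have hA : ∀ J, (fun e => (((Q j).abSign e : ℤ) : ℝ) * J e) ∈ A ↔ J ∈ A := by
      intro J
      simp only [hAdef, Set.mem_iInter, Set.mem_compl_iff]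
      refine forall₂_congr fun i _ => not_congr ((Q i).mem_shieldEvent_congr fun e => ?_)
      rw [abs_mul, abs_intUnit_cast, one_mul]
    have hz := (Q j).integral_shielded_eq_zero hdeg u v (hk j (by simp)) hA
    have hint : ∀ {B : Set (G.edgeSet → ℝ)}, MeasurableSet B →
        Integrable (fun J => B.indicator (relativeSpin G u v) J * hermitePi k J)
          (stdGaussianPi G.edgeSet) := fun hB =>
      (memLp_indicator_relativeSpin G huv hB).integrable_mul (memLp_hermitePi k)
    rw [← add_zero (∫ J, ((Q j).shieldEventᶜ ∩ A).indicator (relativeSpin G u v) J *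
        hermitePi k J ∂(stdGaussianPi G.edgeSet)), ← hz, ← integral_add
        (hint ((Q j).measurableSet_shieldEvent.compl.inter hAm))
        (hint (hAm.inter (Q j).measurableSet_shieldEvent))]
    refine integral_congr_ae (ae_of_all _ fun J => ?_)
    by_cases h1 : J ∈ A <;> by_cases h2 : J ∈ (Q j).shieldEvent <;> simp [h1, h2]

/-- Lower bound for the probability that a coupling is strong, respectively weak. -/
noncomputable def shieldProb : ENNReal :=
  min (gaussianReal 0 1 {x | 16 < |x|}) (gaussianReal 0 1 {x | |x| ≤ 1})

theorem shieldProb_pos : 0 < shieldProb := by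
  have h : ∀ s : Set ℝ, (interior s).Nonempty → 0 < gaussianReal 0 1 s := by
    intro s hs
    refine pos_iff_ne_zero.2 fun h0 => ?_
    have := gaussianReal_absolutelyContinuous' 0 one_ne_zero h0
    exact (Measure.measure_pos_of_nonempty_interior volume hs).ne' this
  refine lt_min (h _ ⟨17, ?_⟩) (h _ ⟨0, ?_⟩)
  · rw [mem_interior]
    refine ⟨Set.Ioi 16, fun x (hx : 16 < x) => lt_of_lt_of_le hx (le_abs_self x), isOpen_Ioi, ?_⟩
    norm_num
  · rw [mem_interior]
    refine ⟨Set.Ioo (-1) 1, fun x hx => abs_le.2 ⟨hx.1.le, hx.2.le⟩, isOpen_Ioo, ?_⟩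
    norm_num

theorem shieldProb_le_one : shieldProb ≤ 1 := (min_le_left _ _).trans prob_le_one

theorem FourCycle.measure_compl_shieldEvent_le (hdeg : ∀ x, G.degree x ≤ 4) (Q : FourCycle G) :
    stdGaussianPi G.edgeSet Q.shieldEventᶜ ≤ 1 - shieldProb ^ 16 := by
  rw [prob_compl_eq_one_sub Q.measurableSet_shieldEvent]
  refine tsub_le_tsub_left ?_ _
  refine le_trans ?_ (pow_card_le_measure_boxEvent Q.block (I := Q.range) (p := shieldProb) ?_)
  · exact pow_le_pow_right_of_le_one' shieldProb_le_one (Q.card_block_le hdeg)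
  · intro e _
    unfold FourCycle.range
    split_ifs
    · exact min_le_left _ _
    · exact min_le_right _ _

/-- The mass of the multi-indices that are odd on the distinguished edges of `m` four-cycles with
disjoint neighborhoods is exponentially small in `m`. -/
theorem tsum_sq_fourierCoeff_le (hdeg : ∀ x, G.degree x ≤ 4) {u v : V}
    (huv : G.Reachable u v) {κ : Type*} (t : Finset κ) (Q : κ → FourCycle G)
    (hQ : (t : Set κ).PairwiseDisjoint fun j => (Q j).block) :
    ∑' k : {k : G.edgeSet → ℕ | ∀ j ∈ t, Odd (k (Q j).ab)},
      ENNReal.ofReal (fourierCoeff G u v k.1 ^ 2) ≤ (1 - shieldProb ^ 16) ^ t.card := by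
  have hAm : MeasurableSet (⋂ j ∈ t, ((Q j).shieldEvent)ᶜ) :=
    Finset.measurableSet_biInter _ fun i _ => (Q i).measurableSet_shieldEvent.compl
  have h := tsum_sq_integral_mul_hermitePi_le (memLp_indicator_relativeSpin G huv hAm)
    {k : G.edgeSet → ℕ | ∀ j ∈ t, Odd (k (Q j).ab)}
  have hcongr : ∀ k : {k : G.edgeSet → ℕ | ∀ j ∈ t, Odd (k (Q j).ab)},
      fourierCoeff G u v k.1 = _ := fun k =>
    fourierCoeff_eq_integral_indicator hdeg huv t Q k.2
  simp only [hcongr]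
  refine h.trans ?_
  have hsq : (fun J => (⋂ j ∈ t, ((Q j).shieldEvent)ᶜ).indicator (relativeSpin G u v) J ^ 2) =
      (⋂ j ∈ t, ((Q j).shieldEvent)ᶜ).indicator 1 := by
    funext J
    by_cases hJ : J ∈ ⋂ j ∈ t, ((Q j).shieldEvent)ᶜ
    · rw [Set.indicator_of_mem hJ, Set.indicator_of_mem hJ, ← sq_abs, abs_relativeSpin]
      simp
    · rw [Set.indicator_of_notMem hJ, Set.indicator_of_notMem hJ]
      simp
  rw [hsq, integral_indicator_one hAm, ofReal_measureReal]
  exact measure_iInter_compl_boxEvent_le t _ _ (fun j => (Q j).measurableSet_range) hQ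
    fun j _ => (Q j).measure_compl_shieldEvent_le hdeg

end Squares

/-! ### Column crossings of short paths in the grid, and their entropy. -/

section Crossings

/-- The total vertical variation of a sequence of heights with prescribed start and end. -/
def crossCost : ℤ → List ℤ → ℤ → ℕ
  | y, [], y' => (y - y').natAbs
  | y, a :: l, y' => (y - a).natAbs + crossCost a l y'

theorem crossCost_le (y z : ℤ) (l : List ℤ) (y' : ℤ) :
    crossCost y l y' ≤ (y - z).natAbs + crossCost z l y' := by
  cases l <;> simp only [crossCost] <;> omega

/-- Parity later absorbs an additive `1` in the path length bound, so that the final estimate holds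
for small `n` too. -/
theorem even_crossCost (y : ℤ) (l : List ℤ) : Even (crossCost y l y) := by
  have h : ∀ (l : List ℤ) (a b : ℤ), Even ((crossCost a l b : ℤ) - (a - b)) := by
    intro l
    induction l with
    | nil =>
      intro a b
      simp only [crossCost, Int.even_iff]
      omega
    | cons c l ih =>
      intro a b
      have := ih c b
      simp only [crossCost, Int.even_iff] at this ⊢
      omega
  have := h l y y
  rw [sub_self, sub_zero] at this
  exact_mod_cast this

/-- The lists of length `k` with entries in `s`. -/
def heightLists (s : Finset ℤ) : ℕ → Finset (List ℤ)
  | 0 => {[]}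
  | k + 1 => (s ×ˢ heightLists s k).image fun p => p.1 :: p.2

theorem mem_heightLists {s : Finset ℤ} {k : ℕ} {l : List ℤ} :
    l ∈ heightLists s k ↔ l.length = k ∧ ∀ a ∈ l, a ∈ s := by
  induction k generalizing l with
  | zero => simp +contextual [heightLists, List.length_eq_zero_iff]
  | succ k ih =>
    cases l with
    | nil => simp [heightLists]
    | cons a l =>
      simp only [heightLists, Finset.mem_image, Finset.mem_product, Prod.exists, List.cons.injEq,
        ih, List.length_cons, List.mem_cons, forall_eq_or_imp, Nat.add_right_cancel_iff]
      constructor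
      · rintro ⟨a, l, ⟨h1, h2, h3⟩, rfl, rfl⟩
        exact ⟨h2, h1, h3⟩
      · rintro ⟨h2, h1, h3⟩
        exact ⟨a, l, ⟨h1, h2, h3⟩, rfl, rfl⟩

/-- The weight factorizes over successive increments; each summed height costs a factor `C`, and the
last increment, to the fixed `y'`, costs at most `1`. -/
theorem sum_pow_crossCost_le {s : Finset ℤ} {r C : ℝ} (hr0 : 0 ≤ r) (hr1 : r ≤ 1)
    (hC : ∀ y, ∑ a ∈ s, r ^ (y - a).natAbs ≤ C) (k : ℕ) (y y' : ℤ) :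
    ∑ l ∈ heightLists s k, r ^ crossCost y l y' ≤ C ^ k := by
  have hC0 : 0 ≤ C := (Finset.sum_nonneg fun _ _ => pow_nonneg hr0 _).trans (hC 0)
  induction k generalizing y with
  | zero => simpa [heightLists, crossCost] using pow_le_one₀ hr0 hr1
  | succ k ih =>
    rw [heightLists, Finset.sum_image (by
      rintro ⟨a, l⟩ _ ⟨b, l'⟩ _ h
      simpa using h), Finset.sum_product, pow_succ']
    calc ∑ a ∈ s, ∑ l ∈ heightLists s k, r ^ crossCost y (a :: l) y'
        = ∑ a ∈ s, r ^ (y - a).natAbs * ∑ l ∈ heightLists s k, r ^ crossCost a l y' := by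
          refine Finset.sum_congr rfl fun a _ => ?_
          rw [Finset.mul_sum]
          exact Finset.sum_congr rfl fun l _ => by rw [crossCost, pow_add]
      _ ≤ ∑ a ∈ s, r ^ (y - a).natAbs * C ^ k :=
          Finset.sum_le_sum fun a _ => mul_le_mul_of_nonneg_left (ih a) (pow_nonneg hr0 _)
      _ = (∑ a ∈ s, r ^ (y - a).natAbs) * C ^ k := by rw [Finset.sum_mul]
      _ ≤ C * C ^ k := mul_le_mul_of_nonneg_right (hC y) (pow_nonneg hC0 k)

theorem sum_pow_natAbs_le (s : Finset ℤ) {r : ℝ} (hr0 : 0 ≤ r) (hr1 : r < 1) (y : ℤ) :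
    ∑ a ∈ s, r ^ (y - a).natAbs ≤ (1 + r) / (1 - r) := by
  have hgeo : ∀ t : Finset ℕ, ∑ m ∈ t, r ^ m ≤ (1 - r)⁻¹ := by
    intro t
    rw [← tsum_geometric_of_lt_one hr0 hr1]
    exact (summable_geometric_of_lt_one hr0 hr1).sum_le_tsum t fun _ _ => pow_nonneg hr0 _
  rw [← Finset.sum_filter_add_sum_filter_not s (fun a => y ≤ a)]
  have h1 : ∑ a ∈ s with y ≤ a, r ^ (y - a).natAbs ≤ (1 - r)⁻¹ := by
    rw [← Finset.sum_image (s := s.filter fun a => y ≤ a) (g := fun a => (y - a).natAbs)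
      (f := fun m => r ^ m)]
    · exact hgeo _
    · intro a ha b hb h
      simp only [Finset.coe_filter, Set.mem_ofPred_eq] at ha hb h
      omega
  have h2 : ∑ a ∈ s with ¬ y ≤ a, r ^ (y - a).natAbs ≤ r * (1 - r)⁻¹ := by
    have e : ∑ a ∈ s with ¬ y ≤ a, r ^ (y - a).natAbs =
        r * ∑ a ∈ s with ¬ y ≤ a, r ^ ((y - a).natAbs - 1) := by
      rw [Finset.mul_sum]
      refine Finset.sum_congr rfl fun a ha => ?_
      have := (Finset.mem_filter.1 ha).2
      rw [← pow_succ']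
      congr 1
      omega
    rw [e, ← Finset.sum_image (s := s.filter fun a => ¬ y ≤ a)
      (g := fun a => (y - a).natAbs - 1) (f := fun m => r ^ m)]
    · exact mul_le_mul_of_nonneg_left (hgeo _) hr0
    · intro a ha b hb h
      simp only [Finset.coe_filter, Set.mem_ofPred_eq] at ha hb h
      omega
  calc _ ≤ (1 - r)⁻¹ + r * (1 - r)⁻¹ := add_le_add h1 h2
    _ = (1 + r) / (1 - r) := by rw [div_eq_mul_inv]; ring

variable {n : ℕ}

theorem grid_adj {p q : GridVertex n} :
    (grid n).Adj p q ↔ (p.1.1 - q.1.1).natAbs + (p.1.2 - q.1.2).natAbs = 1 := by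
  change |p.1.1 - q.1.1| + |p.1.2 - q.1.2| = 1 ↔ _
  rw [Int.abs_eq_natAbs, Int.abs_eq_natAbs]
  exact_mod_cast Iff.rfl

theorem natAbs_add_natAbs_le_length {H : SimpleGraph (GridVertex n)} (hH : H ≤ grid n)
    {p q : GridVertex n} (w : H.Walk p q) :
    (p.1.1 - q.1.1).natAbs + (p.1.2 - q.1.2).natAbs ≤ w.length := by
  induction w with
  | nil => simp
  | cons h w ih =>
    have := grid_adj.1 (hH h)
    rw [SimpleGraph.Walk.length_cons]
    omega

/-- The graph `H` has horizontal edges at the heights `l` in the consecutive columns starting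
at `x`. -/
def Crosses (H : SimpleGraph (GridVertex n)) : ℤ → List ℤ → Prop
  | _, [] => True
  | x, a :: l => (∃ p q, H.Adj p q ∧ p.1 = (x, a) ∧ q.1 = (x + 1, a)) ∧ Crosses H (x + 1) l

/-- Keep one crossing per column gap: the `k` kept horizontal steps and the vertical variation
between them are paid by distinct parts of the walk. -/
theorem exists_crosses {H : SimpleGraph (GridVertex n)} (hH : H ≤ grid n)
    {p q : GridVertex n} (w : H.Walk p q) (k : ℕ) (hk : q.1.1 = p.1.1 + k) :
    ∃ l : List ℤ, l.length = k ∧ Crosses H p.1.1 l ∧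
      crossCost p.1.2 l q.1.2 + k ≤ w.length := by
  induction w generalizing k with
  | nil =>
    have : k = 0 := by omega
    subst this
    exact ⟨[], rfl, trivial, by simp [crossCost]⟩
  | @cons p r q h w ih =>
    have hadj := grid_adj.1 (hH h)
    rw [SimpleGraph.Walk.length_cons]
    have hcases : r.1.1 = p.1.1 ∨ (r.1.1 = p.1.1 + 1 ∧ r.1.2 = p.1.2) ∨
        (r.1.1 + 1 = p.1.1 ∧ r.1.2 = p.1.2) := by omega
    rcases hcases with hx | ⟨hx, hy⟩ | ⟨hx, hy⟩
    · obtain ⟨l, hl, hc, hlen⟩ := ih k (by omega)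
      refine ⟨l, hl, hx ▸ hc, ?_⟩
      have := crossCost_le p.1.2 r.1.2 l q.1.2
      omega
    · cases k with
      | zero =>
        refine ⟨[], rfl, trivial, ?_⟩
        have := natAbs_add_natAbs_le_length hH w
        simp only [crossCost]
        omega
      | succ k =>
        obtain ⟨l, hl, hc, hlen⟩ := ih k (by push_cast at hk; omega)
        refine ⟨p.1.2 :: l, by simp [hl], ⟨⟨p, r, h, rfl, Prod.ext hx hy⟩, hx ▸ hc⟩, ?_⟩
        simp only [crossCost, sub_self, Int.natAbs_zero, zero_add]
        rw [← hy]
        omega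
    -- After a step to the left, the rest of the walk recrosses the same gap; that crossing is
    -- dropped.
    · obtain ⟨l, hl, hc, hlen⟩ := ih (k + 1) (by push_cast; omega)
      cases l with
      | nil => simp at hl
      | cons a l =>
        refine ⟨l, by simpa using hl, hx ▸ hc.2, ?_⟩
        have := crossCost_le p.1.2 a l q.1.2
        simp only [crossCost] at hlen
        rw [hy] at hlen
        omega

theorem Crosses.getElem {H : SimpleGraph (GridVertex n)} {x : ℤ} {l : List ℤ}
    (h : Crosses H x l) (i : ℕ) (hi : i < l.length) :
    ∃ p q, H.Adj p q ∧ p.1 = (x + i, l[i]) ∧ q.1 = (x + i + 1, l[i]) := by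
  induction l generalizing x i with
  | nil => simp at hi
  | cons a l ih =>
    cases i with
    | zero => simpa using h.1
    | succ i =>
      obtain ⟨p, q, hpq, hp, hq⟩ := ih h.2 i (by simpa using hi)
      refine ⟨p, q, hpq, ?_, ?_⟩
      · rw [hp]; simp; ring
      · rw [hq]; simp; ring

theorem Crosses.mem_Icc {H : SimpleGraph (GridVertex n)} {x : ℤ} {l : List ℤ}
    (h : Crosses H x l) : ∀ a ∈ l, a ∈ Finset.Icc (1 : ℤ) n := by
  intro a ha
  obtain ⟨i, hi, rfl⟩ := List.getElem_of_mem ha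
  obtain ⟨p, q, -, hp, -⟩ := h.getElem i hi
  have := (Finset.mem_product.1 p.2).2
  rwa [hp] at this

theorem degree_grid_le (x : GridVertex n) : (grid n).degree x ≤ 4 := by
  rw [← SimpleGraph.card_neighborFinset_eq_degree]
  have hsub : ((grid n).neighborFinset x).image (fun p => p.1) ⊆
      {(x.1.1 + 1, x.1.2), (x.1.1 - 1, x.1.2), (x.1.1, x.1.2 + 1), (x.1.1, x.1.2 - 1)} := by
    intro p hp
    obtain ⟨q, hq, rfl⟩ := Finset.mem_image.1 hp
    rw [SimpleGraph.mem_neighborFinset, grid_adj] at hq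
    simp only [Finset.mem_insert, Finset.mem_singleton, Prod.ext_iff]
    omega
  rw [← Finset.card_image_of_injective _ Subtype.val_injective]
  exact (Finset.card_le_card hsub).trans Finset.card_le_four

theorem grid_reachable (hn : 2 ≤ n) :
    (grid n).Reachable (leftVertex n hn) (rightVertex n hn) := by
  have h : ∀ i : ℕ, ∀ hi : i + 1 ≤ n, (grid n).Reachable (leftVertex n hn)
      ⟨((i : ℤ) + 1, (n : ℤ) / 2), by
        simp only [Finset.mem_product, Finset.mem_Icc]; omega⟩ := by
    intro i
    induction i with
    | zero =>
      intro hi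
      exact SimpleGraph.Reachable.refl (G := grid n) (leftVertex n hn)
    | succ i ih =>
      intro hi
      refine (ih (by omega)).trans (SimpleGraph.Adj.reachable ?_)
      rw [grid_adj]
      simp
  have := h (n - 1) (by omega)
  convert this using 1
  refine Subtype.ext (Prod.ext ?_ rfl)
  change (n : ℤ) = ((n - 1 : ℕ) : ℤ) + 1
  omega

/-- The unit square adjacent to the horizontal edge from `(x, y)` to `(x + 1, y)`. -/
def gridSquare (hn : 2 ≤ n) (x y : ℤ) (hx : 1 ≤ x ∧ x < n) (hy : y ∈ Finset.Icc (1 : ℤ) n) :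
    FourCycle (grid n) where
  a := ⟨(x, y), by simp only [Finset.mem_product, Finset.mem_Icc] at hy ⊢; omega⟩
  b := ⟨(x + 1, y), by simp only [Finset.mem_product, Finset.mem_Icc] at hy ⊢; omega⟩
  -- The square lies above the edge, except in the top row, where it lies below.
  c := ⟨(x, if y < n then y + 1 else y - 1), by
    simp only [Finset.mem_product, Finset.mem_Icc] at hy ⊢; split_ifs <;> omega⟩
  d := ⟨(x + 1, if y < n then y + 1 else y - 1), by
    simp only [Finset.mem_product, Finset.mem_Icc] at hy ⊢; split_ifs <;> omega⟩
  hab := by rw [grid_adj]; simp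
  hac := by rw [grid_adj]; split_ifs <;> simp
  hbd := by rw [grid_adj]; split_ifs <;> simp
  hcd := by rw [grid_adj]; simp
  had := fun h => by simp at h
  hbc := fun h => by simp at h

theorem exists_mem_of_mem_block_gridSquare (hn : 2 ≤ n) {x y : ℤ} (hx : 1 ≤ x ∧ x < n)
    (hy : y ∈ Finset.Icc (1 : ℤ) n) {e : (grid n).edgeSet}
    (he : e ∈ (gridSquare hn x y hx hy).block) :
    ∃ p ∈ e.1, x ≤ p.1.1 ∧ p.1.1 ≤ x + 1 := by
  rw [FourCycle.block, Finset.mem_filter] at he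
  rcases he.2 with h | h | h | h
  · exact ⟨_, h, le_refl x, (lt_add_one x).le⟩
  · exact ⟨_, h, (lt_add_one x).le, le_refl (x + 1)⟩
  · exact ⟨_, h, le_refl x, (lt_add_one x).le⟩
  · exact ⟨_, h, (lt_add_one x).le, le_refl (x + 1)⟩

theorem abs_sub_le_one_of_mem_edge {e : (grid n).edgeSet} {p q : GridVertex n} (hp : p ∈ e.1)
    (hq : q ∈ e.1) : (p.1.1 - q.1.1).natAbs ≤ 1 := by
  obtain ⟨e, he⟩ := e
  induction e using Sym2.ind with
  | _ a b =>
    have hab := grid_adj.1 (show (grid n).Adj a b from he)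
    rcases Sym2.mem_iff.1 hp with rfl | rfl <;> rcases Sym2.mem_iff.1 hq with rfl | rfl
    · simp
    · omega
    · omega
    · simp

/-- An edge spans at most one column step and each square two adjacent columns, so a common edge
would force `|x - x'| ≤ 2`. -/
theorem disjoint_block_gridSquare (hn : 2 ≤ n) {x y x' y' : ℤ} (hx : 1 ≤ x ∧ x < n)
    (hy : y ∈ Finset.Icc (1 : ℤ) n) (hx' : 1 ≤ x' ∧ x' < n) (hy' : y' ∈ Finset.Icc (1 : ℤ) n)
    (h : 3 ≤ (x - x').natAbs) :
    Disjoint (gridSquare hn x y hx hy).block (gridSquare hn x' y' hx' hy').block := by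
  rw [Finset.disjoint_left]
  intro e he he'
  obtain ⟨p, hp, h1, h2⟩ := exists_mem_of_mem_block_gridSquare hn hx hy he
  obtain ⟨q, hq, h3, h4⟩ := exists_mem_of_mem_block_gridSquare hn hx' hy' he'
  have := abs_sub_le_one_of_mem_edge hp hq
  omega

theorem tsum_sq_fourierCoeff_crosses_le (hn : 2 ≤ n) {l : List ℤ}
    (hl : l ∈ heightLists (Finset.Icc (1 : ℤ) n) (n - 1)) :
    ∑' k : {k : (grid n).edgeSet → ℕ | Crosses (oddGraph (grid n) k) 1 l},
      ENNReal.ofReal (fourierCoeff (grid n) (leftVertex n hn) (rightVertex n hn) k.1 ^ 2) ≤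
      (1 - shieldProb ^ 16) ^ ((n + 1) / 3) := by
  obtain ⟨hlen, hmem⟩ := mem_heightLists.1 hl
  -- Every third of the `n - 1` gaps is used, which gives `⌈(n - 1)/3⌉ = ⌊(n + 1)/3⌋` squares.
  have hidx : ∀ j : Fin ((n + 1) / 3), 3 * (j : ℕ) < l.length := by
    intro j
    have := j.2
    omega
  let Q : Fin ((n + 1) / 3) → FourCycle (grid n) := fun j =>
    gridSquare hn (1 + (3 * (j : ℕ) : ℕ)) (l[3 * (j : ℕ)]'(hidx j))
      (by have := hidx j; omega) (hmem _ (List.getElem_mem _))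
  have h := tsum_sq_fourierCoeff_le degree_grid_le (grid_reachable hn) Finset.univ Q (by
    intro i _ j _ hij
    refine disjoint_block_gridSquare hn _ _ _ _ ?_
    have : (i : ℕ) ≠ j := fun h => hij (Fin.ext h)
    push_cast
    omega)
  rw [Finset.card_univ, Fintype.card_fin] at h
  refine le_trans (ENNReal.tsum_mono_subtype (fun k => ENNReal.ofReal
    (fourierCoeff (grid n) (leftVertex n hn) (rightVertex n hn) k ^ 2)) ?_) h
  intro k hk j _
  obtain ⟨p, q, hpq, hp, hq⟩ := Crosses.getElem hk _ (hidx j)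
  obtain ⟨hadj, hodd⟩ := (oddGraph_adj (grid n)).1 hpq
  have ep : p = (Q j).a := Subtype.ext hp
  have eq : q = (Q j).b := Subtype.ext hq
  subst ep eq
  exact hodd

theorem exists_heightList (hn : 2 ≤ n) {ε : ℝ} (hε : 0 ≤ ε) {k : (grid n).edgeSet → ℕ}
    (hk : fourierCoeff (grid n) (leftVertex n hn) (rightVertex n hn) k ≠ 0)
    (hcard : ((edgeSupport (grid n) k).card : ℝ) ≤ (1 + ε) * n) :
    ∃ l ∈ heightLists (Finset.Icc (1 : ℤ) n) (n - 1), Crosses (oddGraph (grid n) k) 1 l ∧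
      (crossCost ((n : ℤ) / 2) l ((n : ℤ) / 2) : ℝ) ≤ 2 * ε * n := by
  classical
  obtain ⟨w, hw⟩ := (reachable_oddGraph (grid n) (grid_reachable hn) hk).exists_isPath
  have hlen : w.length ≤ (edgeSupport (grid n) k).card := by
    rw [← SimpleGraph.Walk.length_edges, ← List.toFinset_card_of_nodup hw.isTrail.edges_nodup,
      ← Finset.card_map (Function.Embedding.subtype _) (s := edgeSupport (grid n) k)]
    refine Finset.card_le_card fun e he => ?_
    have he' := w.edges_subset_edgeSet (List.mem_toFinset.1 he)
    rw [oddGraph, SimpleGraph.edgeSet_fromEdgeSet] at he'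
    obtain ⟨⟨h1, h2⟩, -⟩ := he'
    refine Finset.mem_map.2 ⟨⟨e, h1⟩, ?_, rfl⟩
    rw [edgeSupport, Finset.mem_filter]
    exact ⟨Finset.mem_univ _, h2.pos⟩
  have hle : oddGraph (grid n) k ≤ grid n := fun x y h => ((oddGraph_adj (grid n)).1 h).1
  obtain ⟨l, hl, hc, hcost⟩ := exists_crosses hle w (n - 1) (by
    change (n : ℤ) = 1 + ((n - 1 : ℕ) : ℤ)
    omega)
  refine ⟨l, mem_heightLists.2 ⟨hl, hc.mem_Icc⟩, hc, ?_⟩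
  have hc2 : crossCost ((n : ℤ) / 2) l ((n : ℤ) / 2) + n ≤ (edgeSupport (grid n) k).card + 1 := by
    have : crossCost ((n : ℤ) / 2) l ((n : ℤ) / 2) + (n - 1) ≤ w.length := hcost
    omega
  have hc3 : (crossCost ((n : ℤ) / 2) l ((n : ℤ) / 2) : ℝ) + n ≤
      (edgeSupport (grid n) k).card + 1 := by exact_mod_cast hc2
  obtain ⟨m, hm⟩ := even_crossCost ((n : ℤ) / 2) l
  rw [hm] at hc3 ⊢
  -- The cost `2m` is at most `εn + 1`. Either `m = 0`, or `m ≤ 2m - 1 ≤ εn`.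
  rcases Nat.eq_zero_or_pos m with rfl | hpos
  · simp only [add_zero, Nat.cast_zero]
    positivity
  · have : (1 : ℝ) ≤ m := by exact_mod_cast hpos
    push_cast at hc3 ⊢
    linarith

end Crossings

/-! ### Entropy against decay: the union bound. -/

section Final

theorem exists_rate : ∃ κ : ℝ, 0 < κ ∧ 1 - shieldProb ^ 16 ≤ ENNReal.ofReal (Real.exp (-κ)) := by
  have hlt : 1 - shieldProb ^ 16 < 1 :=
    ENNReal.sub_lt_self ENNReal.one_ne_top one_ne_zero (pow_ne_zero 16 shieldProb_pos.ne')
  -- A strictly larger `r` is taken so that `r > 0` and its logarithm is meaningful.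
  obtain ⟨r, hr1, hr2⟩ := ENNReal.lt_iff_exists_nnreal_btwn.1 hlt
  have hr : (r : ℝ) < 1 := by exact_mod_cast hr2
  have hr0 : 0 < (r : ℝ) := by
    have : (0 : ENNReal) < r := lt_of_le_of_lt zero_le hr1
    exact_mod_cast this
  refine ⟨-Real.log r, neg_pos.2 (Real.log_neg hr0 hr), ?_⟩
  rw [neg_neg, Real.exp_log hr0, ENNReal.ofReal_coe_nnreal]
  exact hr1.le

/-- Exponential Markov inequality: each counted list has `1 ≤ exp (t * (b - cost))`. -/
theorem card_heightLists_crossCost_le {s : Finset ℤ} {t C b : ℝ} (ht : 0 ≤ t)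
    (hC : ∀ y, ∑ a ∈ s, Real.exp (-t) ^ (y - a).natAbs ≤ C) (k : ℕ) (y y' : ℤ) :
    (((heightLists s k).filter fun l => (crossCost y l y' : ℝ) ≤ b).card : ℝ) ≤
      Real.exp (t * b) * C ^ k := by
  have h := sum_pow_crossCost_le (Real.exp_pos (-t)).le
    (Real.exp_le_one_iff.2 (neg_nonpos.2 ht)) hC k y y'
  refine le_trans ?_ (mul_le_mul_of_nonneg_left h (Real.exp_pos _).le)
  rw [Finset.mul_sum, ← mul_one (Finset.card _ : ℝ), ← nsmul_eq_mul, ← Finset.sum_const]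
  refine (Finset.sum_le_sum fun l hl => ?_).trans (Finset.sum_le_sum_of_subset_of_nonneg
    (Finset.filter_subset _ _) fun l _ _ => by positivity)
  have hl' := (Finset.mem_filter.1 hl).2
  rw [← Real.exp_nat_mul, ← Real.exp_add, Real.one_le_exp_iff]
  nlinarith

theorem spectralMass_eq_tsum_ite {V : Type*} [Fintype V] [DecidableEq V] (G : SimpleGraph V)
    [DecidableRel G.Adj] (u v : V) (S : Finset G.edgeSet) :
    spectralMass G u v S = ∑' k, if edgeSupport G k = S
      then ENNReal.ofReal (fourierCoeff G u v k ^ 2) else 0 := by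
  have h := tsum_subtype {k | edgeSupport G k = S}
    (fun k => ENNReal.ofReal (fourierCoeff G u v k ^ 2))
  refine Eq.trans h (tsum_congr fun k => ?_)
  by_cases hk : edgeSupport G k = S
  · rw [if_pos hk, Set.indicator_of_mem (show k ∈ {k | edgeSupport G k = S} from hk)]
  · rw [if_neg hk, Set.indicator_of_notMem (show k ∉ {k | edgeSupport G k = S} from hk)]

/-- The low-degree spectral mass is at most a union over the possible sequences of crossings. -/
theorem sum_spectralMass_le {n : ℕ} (hn : 2 ≤ n) {ε : ℝ} (hε : 0 ≤ ε) :
    ∑ S : Finset (grid n).edgeSet with (S.card : ℝ) ≤ (1 + ε) * n,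
      spectralMass (grid n) (leftVertex n hn) (rightVertex n hn) S ≤
    (((heightLists (Finset.Icc (1 : ℤ) n) (n - 1)).filter fun l =>
      (crossCost ((n : ℤ) / 2) l ((n : ℤ) / 2) : ℝ) ≤ 2 * ε * n).card : ENNReal) *
      (1 - shieldProb ^ 16) ^ ((n + 1) / 3) := by
  classical
  set L := (heightLists (Finset.Icc (1 : ℤ) n) (n - 1)).filter fun l =>
      (crossCost ((n : ℤ) / 2) l ((n : ℤ) / 2) : ℝ) ≤ 2 * ε * n with hL
  set F : ((grid n).edgeSet → ℕ) → ENNReal := fun k =>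
    ENNReal.ofReal (fourierCoeff (grid n) (leftVertex n hn) (rightVertex n hn) k ^ 2) with hF
  have hmass : ∀ S, spectralMass (grid n) (leftVertex n hn) (rightVertex n hn) S =
      ∑' k, if edgeSupport (grid n) k = S then F k else 0 := by
    intro S
    rw [spectralMass_eq_tsum_ite]
  simp only [hmass]
  rw [← Summable.tsum_finsetSum fun _ _ => ENNReal.summable]
  -- A given `k` has a single support `S`; if it counts and `α_k ≠ 0`, some admissible list is
  -- crossed by its odd edges.
  have hpt : ∀ k, (∑ S : Finset (grid n).edgeSet with (S.card : ℝ) ≤ (1 + ε) * n,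
      if edgeSupport (grid n) k = S then F k else 0) ≤
      ∑ l ∈ L, {k | Crosses (oddGraph (grid n) k) 1 l}.indicator F k := by
    intro k
    rw [Finset.sum_ite_eq]
    split_ifs with hk
    · by_cases h0 : fourierCoeff (grid n) (leftVertex n hn) (rightVertex n hn) k = 0
      · simp [hF, h0]
      · obtain ⟨l, hl, hc, hcost⟩ := exists_heightList hn hε h0 (Finset.mem_filter.1 hk).2
        have hlL : l ∈ L := Finset.mem_filter.2 ⟨hl, hcost⟩
        refine le_trans ?_ (Finset.single_le_sum (fun _ _ => zero_le) hlL)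
        rw [Set.indicator_of_mem (show k ∈ {k | Crosses (oddGraph (grid n) k) 1 l} from hc)]
    · exact zero_le
  refine (ENNReal.tsum_le_tsum hpt).trans ?_
  rw [Summable.tsum_finsetSum fun _ _ => ENNReal.summable, ← nsmul_eq_mul, ← Finset.sum_const]
  refine Finset.sum_le_sum fun l hl => ?_
  rw [← tsum_subtype]
  exact tsum_sq_fourierCoeff_crosses_le hn (Finset.mem_filter.1 hl).1

end Final

end EdwardsAnderson

theorem theorem2p3 :
    ∃ ε : ℝ, 0 < ε ∧ ∃ c : ℝ, 0 < c ∧ ∀ (n : ℕ) (hn : 2 ≤ n), Even n →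
      ∑ S : Finset (EdwardsAnderson.grid n).edgeSet with (S.card : ℝ) ≤ (1 + ε) * n,
          EdwardsAnderson.spectralMass (EdwardsAnderson.grid n)
            (EdwardsAnderson.leftVertex n hn) (EdwardsAnderson.rightVertex n hn) S
        ≤ ENNReal.ofReal (Real.exp (-(c * n))) := by
  obtain ⟨κ, hκ, hq⟩ := EdwardsAnderson.exists_rate
  -- `r = exp (-t)` is small enough for the crossings to have small entropy
  obtain ⟨r, hr0, hr1, hr⟩ : ∃ r : ℝ, 0 < r ∧ r < 1 ∧ (1 + r) / (1 - r) ≤ Real.exp (κ / 6) := by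
    -- This `r` solves `(1 + r) / (1 - r) = 1 + κ / 6`.
    refine ⟨κ / 6 / (2 + κ / 6), by positivity, ?_, ?_⟩
    · rw [div_lt_one (by positivity)]; linarith
    · refine le_trans ?_ (Real.add_one_le_exp (κ / 6))
      have h2 : 1 - κ / 6 / (2 + κ / 6) = 2 / (2 + κ / 6) := by field_simp; ring
      have h3 : 1 + κ / 6 / (2 + κ / 6) = 2 * (κ / 6 + 1) / (2 + κ / 6) := by field_simp; ring
      rw [h2, h3]
      apply le_of_eq
      field_simp
  have ht : 0 < -Real.log r := neg_pos.2 (Real.log_neg hr0 hr1)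
  set t := -Real.log r with htdef
  have hexp : Real.exp (-t) = r := by rw [htdef, neg_neg, Real.exp_log hr0]
  -- With this `ε` the exponential moment costs `t * 2εn = κn/24`. The remaining entropy is `κ(n -
  -- 1)/6` and the decay at least `κ(n - 1)/3`; the total is at most `-κn/24` exactly when `n ≥ 2`.
  refine ⟨κ / (48 * t), by positivity, κ / 24, by positivity, fun n hn _ => ?_⟩
  refine (EdwardsAnderson.sum_spectralMass_le hn (by positivity)).trans ?_
  have hcard := EdwardsAnderson.card_heightLists_crossCost_le (s := Finset.Icc (1 : ℤ) n)
    (t := t) (C := Real.exp (κ / 6)) (b := 2 * (κ / (48 * t)) * n) ht.le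
    (fun y => by
      rw [hexp]
      exact (EdwardsAnderson.sum_pow_natAbs_le _ hr0.le hr1 y).trans hr)
    (n - 1) ((n : ℤ) / 2) ((n : ℤ) / 2)
  set N := ((EdwardsAnderson.heightLists (Finset.Icc (1 : ℤ) n) (n - 1)).filter fun l =>
    (EdwardsAnderson.crossCost ((n : ℤ) / 2) l ((n : ℤ) / 2) : ℝ) ≤
      2 * (κ / (48 * t)) * n).card
  have hpow : (1 - EdwardsAnderson.shieldProb ^ 16) ^ ((n + 1) / 3) ≤
      ENNReal.ofReal (Real.exp (-κ) ^ ((n + 1) / 3)) := by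
    rw [ENNReal.ofReal_pow (Real.exp_pos _).le]
    exact pow_le_pow_left' hq _
  refine (mul_le_mul_right hpow _).trans ?_
  rw [← ENNReal.ofReal_natCast, ← ENNReal.ofReal_mul (Nat.cast_nonneg _)]
  refine ENNReal.ofReal_le_ofReal ?_
  refine (mul_le_mul_of_nonneg_right hcard (by positivity)).trans ?_
  rw [← Real.exp_nat_mul, ← Real.exp_nat_mul, ← Real.exp_add, ← Real.exp_add, Real.exp_le_exp]
  have hm : (n : ℝ) - 1 ≤ 3 * (((n + 1) / 3 : ℕ) : ℝ) := by
    have : n ≤ 3 * ((n + 1) / 3) + 1 := by omega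
    have h' : (n : ℝ) ≤ 3 * (((n + 1) / 3 : ℕ) : ℝ) + 1 := by exact_mod_cast this
    linarith
  have hn' : (2 : ℝ) ≤ n := by exact_mod_cast hn
  have hcast : ((n - 1 : ℕ) : ℝ) = n - 1 := by
    rw [Nat.cast_sub (by omega)]; simp
  have htb : t * (2 * (κ / (48 * t)) * n) = κ / 24 * n := by
    field_simp
    ring
  rw [hcast, htb]
  nlinarith [mul_le_mul_of_nonneg_left hm hκ.le, mul_le_mul_of_nonneg_left hn' hκ.le]
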